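/- **Setting.** Terms and formulas of the $\epsilon$-calculus for first order arithmetic are generated simultaneously from variables, numerals, function symbols (each interpreted by a function on $\mathbb N$; e.g. $+,\cdot,\dot-$), the relations $=,<$, the propositional connectives, and $\epsilon$-terms $\epsilon x.F$ for formulas $F$. A closed $\epsilon$-term is *canonical* if all its proper closed subterms are numerals. The rank of an $\epsilon$-term $\epsilon x.F$ is $1$ plus the maximal rank of an $\epsilon$-term occurring in $F$ that contains $x$ free ($1$ if there is none); $rk(e)$ of an expression $e$ is the maximal rank of an $\epsilon$-term occurring in $e$ ($0$ if there is none). An $\epsilon$-substitution $S$ is a finite function from canonical terms to $\mathbb N$; $|e|_S$ is the irreducible form of $e$ obtained by replacing closed $\epsilon$-terms, from the inside out, by their $S$-values (default value $0$ outside $dom(S)$) and evaluating function symbols at numerals; $rk(S)=\max(\{rk(e):e\in dom(S)\}\cup\{0\})$. Let $Cr$ be a finite sequence of closed $\epsilon$-axioms $F[t]\to \epsilon x.F[x]\not> t\wedge F[\epsilon x.F[x]]$. $S$ is *solving* (a *solution*) if all members of $Cr$ are true under $S$. Put $\mathrm{RANK}=\max\{rk(Cr)+1,2\}$, where $rk(Cr)$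 is the maximal rank of a member of $Cr$. Let $e_0,\dots,e_{N-1}$ be an enumeration without repetition of the closed $\epsilon$-terms occurring in $Cr$ such that $j>i$ whenever $e_j$ is a proper subterm of $e_i$, and let $ind(S)=\sum_{i<N}(\omega+1)^i\cdot\| |e_i|_S\|$ (summands in order of decreasing $i$), where $\|0\|=\omega$ and $\|x\|=x-1$ for $x>0$. Let $S\mapsto Cr(S)$ be any rule that assigns to each nonsolving $S$ a member $Cr(S)$ of $Cr$ that is false under $S$ and depends only on $ind(S)$; if $Cr(S)$ is given by $F,t$, put $e^S=\epsilon x.|F|_S$ and $v^S=|t|_S$. The *H-process* is $S^0=\emptyset$; $S^{n+1}=S^n$ if $S^n$ is solving; otherwise, with $e=e^{S^n}$ and $v=v^{S^n}$, $$S^{n+1}=\{(f,u)\in S^n: rk(f)<rk(e)\}\cup\{(f,u)\in S^n: rk(f)=rk(e),\ f\neq e\}\cup\{(e,v)\}.$$ Put $r_n=rk(S^n)$ and $a_n=ind(S^n)$ up to and including the first solution, and $r_n=a_n=0$ afterwards. **Series.** For $m\le k$ let $\vec S^{m,k}=(S^n)_{m\le n<k}$ and $rk(\vec S^{m,k})=\min(\{r_i:m<i<k\}\cup\{\mathrm{RANK}\})$.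 $\vec S^{m,k}$ is a *section* if $r_m<rk(\vec S^{m,k})$. Let $m<k$ and $r_m\le rk(\vec S^{m,k})$. If $k_0<\dots<k_l$ are the elements of $\{n\in[m,k): r_n\le rk(\vec S^{n,k})\}$ and $k_{l+1}=k$, the *components* of $\vec S^{m,k}$ are the $\vec S^{k_j,k_{j+1}}$, $j\le l$. $\vec S^{m,k}$ is a *$0$-series* if $k=m+1$, and a *$(p+1)$-series* if each of its components is a $p$-series and a section. A *normal* $p$-series is a $p$-series $\vec S^{m,k}$ with $S^{k-1}$ nonsolving. **Ordinals.** For a nonempty series define $o(\vec S^{m,k};\mathrm{RANK})=a_m$, and for $\xi<\mathrm{RANK}$ let $o(\vec S^{m,k};\xi)=2^{o(\vec T_0;\xi+1)}+\dots+2^{o(\vec T_l;\xi+1)}$, where $\vec T_0,\dots,\vec T_l$ are the pieces obtained by cutting $\vec S^{m,k}$ before each $S^i$ with $m<i<k$ and $r_i=\xi$. Put $o(\vec S)=o(\vec S;0)$. For the empty series let $o=0$. **The function $M$.** $M(0,n)=n+1$. If $S^n$ is solving, $M(p+1,n)=n$. If $S^n$ is nonsolving, let $e_p(i)=o(\vec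 S^{\,i,M(p,i)})$ and $$M(p+1,n)=\begin{cases}M(p,n)&\text{if } e_p(M(p,n))\not<e_p(n),\\ M(p,n)&\text{if } r_{M(p,n)}<r_n \text{ and } e_p(M(p,n))<e_p(n),\\ M(p+1,M(p,n))&\text{if } r_{M(p,n)}\ge r_n \text{ and } e_p(M(p,n))<e_p(n).\end{cases}$$ **Lemma.** 1. For all $p,n$: if $S^n$ is nonsolving, then $\vec S^{n,M(p,n)}$ is a normal $p$-series. 2. For all $p,n,k$: if $\vec S^{n,k}$ is a normal $p$-series, then $k\le M(p,n)$. 3. $S^H$ is a solution for $Cr$, where $H=M(\mathrm{RANK}-1,0)$. -/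

import Mathlib

namespace EpsPA

/-- Function symbols of finite arity, each with its standard interpretation over the natural
numbers (for arithmetic: addition, multiplication, cut-off subtraction and so on). -/
structure Signature where
  Fn : Type
  arity : Fn → ℕ
  interp : (f : Fn) → (Fin (arity f) → ℕ) → ℕ

/-- The two kinds of expressions. -/
inductive Kind
  | term
  | formula

/-- Expressions of the epsilon calculus for arithmetic. Terms and formulas are generated
simultaneously; variables are de Bruijn indices, and `eps F` is the term `εx. F`, which binds the
variable with index `0` in `F`. Every natural number has a numeral `num n`. -/
inductive Expr (L : Signature) : Kind → Type
  | var (i : ℕ) : Expr L Kind.term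
  | num (n : ℕ) : Expr L Kind.term
  | fn (f : L.Fn) (args : Fin (L.arity f) → Expr L Kind.term) : Expr L Kind.term
  | eps (F : Expr L Kind.formula) : Expr L Kind.term
  | eq (s t : Expr L Kind.term) : Expr L Kind.formula
  | lt (s t : Expr L Kind.term) : Expr L Kind.formula
  | neg (A : Expr L Kind.formula) : Expr L Kind.formula
  | conj (A B : Expr L Kind.formula) : Expr L Kind.formula
  | disj (A B : Expr L Kind.formula) : Expr L Kind.formula
  | imp (A B : Expr L Kind.formula) : Expr L Kind.formula

abbrev Term (L : Signature) : Type := Expr L Kind.term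

abbrev Formula (L : Signature) : Type := Expr L Kind.formula

namespace Expr

variable {L : Signature}

/-- The variable with index `i` occurs free in the expression. -/
def Occurs : {k : Kind} → ℕ → Expr L k → Prop
  | _, i, var j => i = j
  | _, _, num _ => False
  | _, i, fn _ a => ∃ c, Occurs i (a c)
  | _, i, eps F => Occurs (i + 1) F
  | _, i, eq s t => Occurs i s ∨ Occurs i t
  | _, i, lt s t => Occurs i s ∨ Occurs i t
  | _, i, neg A => Occurs i A
  | _, i, conj A B => Occurs i A ∨ Occurs i B
  | _, i, disj A B => Occurs i A ∨ Occurs i B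
  | _, i, imp A B => Occurs i A ∨ Occurs i B

def Closed {k : Kind} (e : Expr L k) : Prop := ∀ i, ¬ Occurs i e

/-- The terms occurring in an expression (the expression itself included, if it is a term). -/
def subTerms : {k : Kind} → Expr L k → Set (Term L)
  | _, var i => {var i}
  | _, num n => {num n}
  | _, fn f a => insert (fn f a) (⋃ c, subTerms (a c))
  | _, eps F => insert (eps F) (subTerms F)
  | _, eq s t => subTerms s ∪ subTerms t
  | _, lt s t => subTerms s ∪ subTerms t
  | _, neg A => subTerms A
  | _, conj A B => subTerms A ∪ subTerms B
  | _, disj A B => subTerms A ∪ subTerms B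
  | _, imp A B => subTerms A ∪ subTerms B

/-- Replace the variable with index `i` by the *closed* term `t` (no lifting is needed). -/
def inst (t : Term L) : {k : Kind} → ℕ → Expr L k → Expr L k
  | _, i, var j => if j = i then t else var j
  | _, _, num n => num n
  | _, i, fn f a => fn f (fun c => inst t i (a c))
  | _, i, eps F => eps (inst t (i + 1) F)
  | _, i, eq r s => eq (inst t i r) (inst t i s)
  | _, i, lt r s => lt (inst t i r) (inst t i s)
  | _, i, neg A => neg (inst t i A)
  | _, i, conj A B => conj (inst t i A) (inst t i B)
  | _, i, disj A B => disj (inst t i A) (inst t i B)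
  | _, i, imp A B => imp (inst t i A) (inst t i B)

open Classical in
/-- The largest rank of an epsilon term occurring in the expression and containing the variable
with index `i` free (`0` if there is none). The rank of an epsilon term `εx. F` is one more than
the largest rank of an epsilon term occurring in `F` and containing `x` free. -/
noncomputable def rkAt : {k : Kind} → ℕ → Expr L k → ℕ
  | _, _, var _ => 0
  | _, _, num _ => 0
  | _, i, fn _ a => Finset.univ.sup (fun c => rkAt i (a c))
  | _, i, eps F => max (if Occurs (i + 1) F then rkAt 0 F + 1 else 0) (rkAt (i + 1) F)
  | _, i, eq s t => max (rkAt i s) (rkAt i t)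
  | _, i, lt s t => max (rkAt i s) (rkAt i t)
  | _, i, neg A => rkAt i A
  | _, i, conj A B => max (rkAt i A) (rkAt i B)
  | _, i, disj A B => max (rkAt i A) (rkAt i B)
  | _, i, imp A B => max (rkAt i A) (rkAt i B)

/-- The rank of an expression: the largest rank of an epsilon term occurring in it. -/
noncomputable def rk : {k : Kind} → Expr L k → ℕ
  | _, var _ => 0
  | _, num _ => 0
  | _, fn _ a => Finset.univ.sup (fun c => rk (a c))
  | _, eps F => max (rkAt 0 F + 1) (rk F)
  | _, eq s t => max (rk s) (rk t)
  | _, lt s t => max (rk s) (rk t)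
  | _, neg A => rk A
  | _, conj A B => max (rk A) (rk B)
  | _, disj A B => max (rk A) (rk B)
  | _, imp A B => max (rk A) (rk B)

def IsNum (t : Term L) : Prop := ∃ n, t = num n

/-- The number denoted by a numeral (`0` for all other terms). -/
def numVal : Term L → ℕ
  | num n => n
  | _ => 0

/-- Canonical terms: closed epsilon terms that are minimal, that is, all their proper closed
subterms are numerals. -/
def Canonical (e : Term L) : Prop :=
  ∃ F : Formula L, e = eps F ∧ Closed e ∧ ∀ t ∈ subTerms F, Closed t → IsNum t

end Expr

open EpsPA.Expr

/-- An epsilon substitution: a finite function assigning numbers to canonical terms. -/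
structure Subst (L : Signature) where
  val : Term L → Option ℕ
  finite_dom : {e | val e ≠ none}.Finite
  canonical : ∀ e, val e ≠ none → Canonical e

namespace Subst

variable {L : Signature}

/-- The empty substitution. -/
def empty (L : Signature) : Subst L where
  val := fun _ => none
  finite_dom := by simp
  canonical := by simp

open Classical in
/-- The irreducible form `|e|_S`: closed epsilon terms are replaced, from the inside out, by their
value under `S` (by the default value `0` if they are not in the domain), and function symbols
applied to numerals are evaluated. -/
noncomputable def reduce (S : Subst L) : {k : Kind} → Expr L k → Expr L k
  | _, var i => var i
  | _, num n => num n
  | _, fn f a =>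
      if ∀ c, IsNum (reduce S (a c)) then num (L.interp f (fun c => numVal (reduce S (a c))))
      else fn f (fun c => reduce S (a c))
  | _, eps F =>
      if Closed (eps (reduce S F)) then num ((S.val (eps (reduce S F))).getD 0)
      else eps (reduce S F)
  | _, eq s t => eq (reduce S s) (reduce S t)
  | _, lt s t => lt (reduce S s) (reduce S t)
  | _, neg A => neg (reduce S A)
  | _, conj A B => conj (reduce S A) (reduce S B)
  | _, disj A B => disj (reduce S A) (reduce S B)
  | _, imp A B => imp (reduce S A) (reduce S B)

/-- The value of a closed term under `S`. -/
noncomputable def termVal (S : Subst L) (t : Term L) : ℕ := numVal (S.reduce t)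

/-- Truth of a closed formula under `S`. -/
def Holds (S : Subst L) : Formula L → Prop
  | eq s t => S.termVal s = S.termVal t
  | lt s t => S.termVal s < S.termVal t
  | neg A => ¬ Holds S A
  | conj A B => Holds S A ∧ Holds S B
  | disj A B => Holds S A ∨ Holds S B
  | imp A B => Holds S A → Holds S B

/-- The rank of a substitution: the maximum of `0` and the ranks of the terms in its domain. -/
noncomputable def rk (S : Subst L) : ℕ := S.finite_dom.toFinset.sup Expr.rk

/-- Reduction neither creates nor removes free variables. -/
theorem occurs_reduce (S : Subst L) {k : Kind} (e : Expr L k) (i : ℕ) :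
    Occurs i (S.reduce e) ↔ Occurs i e := by
  induction e generalizing i with
  | var j => simp [reduce]
  | num n => simp [reduce]
  | fn f a ih =>
    rw [reduce]
    split_ifs with h
    · simp only [Occurs, false_iff, not_exists]
      intro c hc
      obtain ⟨n, hn⟩ := h c
      have := (ih c i).2 hc
      rw [hn] at this
      exact this
    · simp only [Occurs, ih]
  | eps F ih =>
    rw [reduce]
    split_ifs with h
    · have := h i
      simp only [Occurs, ih] at this ⊢
      simp [this]
    · simp only [Occurs, ih]
  | eq s t ihs iht => simp [reduce, Occurs, ihs, iht]
  | lt s t ihs iht => simp [reduce, Occurs, ihs, iht]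
  | neg A ih => simp [reduce, Occurs, ih]
  | conj A B ihA ihB => simp [reduce, Occurs, ihA, ihB]
  | disj A B ihA ihB => simp [reduce, Occurs, ihA, ihB]
  | imp A B ihA ihB => simp [reduce, Occurs, ihA, ihB]

/-- A closed term reduces to a numeral, or more generally, the only closed terms that occur in a
reduced expression are numerals. -/
theorem isNum_of_mem_reduce (S : Subst L) {k : Kind} (e : Expr L k) :
    ∀ t ∈ subTerms (S.reduce e), Closed t → IsNum t := by
  induction e with
  | var j =>
    intro t ht hc
    simp only [reduce, subTerms, Set.mem_singleton_iff] at ht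
    subst ht
    exact absurd rfl (hc j)
  | num n =>
    intro t ht _
    exact ⟨n, by simpa [reduce, subTerms] using ht⟩
  | fn f a ih =>
    intro t ht hc
    rw [reduce] at ht
    split_ifs at ht with h
    · exact ⟨_, by simpa [subTerms] using ht⟩
    · simp only [subTerms, Set.mem_insert_iff, Set.mem_iUnion] at ht
      rcases ht with rfl | ⟨c, htc⟩
      · refine absurd (fun c => ih c _ ?_ ?_) h
        · cases S.reduce (a c) <;> simp [subTerms]
        · exact fun i hi => hc i ⟨c, hi⟩
      · exact ih c t htc hc
  | eps F ih =>
    intro t ht hc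
    rw [reduce] at ht
    split_ifs at ht with h
    · exact ⟨_, by simpa [subTerms] using ht⟩
    · simp only [subTerms, Set.mem_insert_iff] at ht
      rcases ht with rfl | htF
      · exact absurd hc h
      · exact ih t htF hc
  | neg A ih => exact ih
  | eq s t ihs iht => exact fun u hu hc => hu.elim (ihs u · hc) (iht u · hc)
  | lt s t ihs iht => exact fun u hu hc => hu.elim (ihs u · hc) (iht u · hc)
  | conj A B ihA ihB => exact fun u hu hc => hu.elim (ihA u · hc) (ihB u · hc)
  | disj A B ihA ihB => exact fun u hu hc => hu.elim (ihA u · hc) (ihB u · hc)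
  | imp A B ihA ihB => exact fun u hu hc => hu.elim (ihA u · hc) (ihB u · hc)

theorem canonical_eps_reduce (S : Subst L) (F : Formula L) (h : Closed (eps F)) :
    Canonical (eps (S.reduce F)) :=
  ⟨_, rfl, fun i hi => h i ((S.occurs_reduce F (i + 1)).1 hi), S.isNum_of_mem_reduce F⟩

open Classical in
/-- Let the canonical term `e` have the value `v`, keep all other values of rank at most the rank
of `e`, and drop the values of larger rank. -/
noncomputable def update (S : Subst L) (e : Term L) (v : ℕ) (he : Canonical e) : Subst L where
  val := fun f => if f = e then some v else if Expr.rk f ≤ Expr.rk e then S.val f else none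
  finite_dom := by
    refine (S.finite_dom.insert e).subset fun f hf => ?_
    by_cases h : f = e
    · exact Or.inl h
    · refine Or.inr fun h0 => hf ?_
      simp [h, h0]
  canonical := by
    intro f hf
    by_cases h : f = e
    · exact h ▸ he
    · refine S.canonical f fun h0 => hf ?_
      simp [h, h0]

end Subst

/-- The data of a closed epsilon axiom
`F[t] → ¬ (εx. F[x] > t) ∧ F[εx. F[x]]`. -/
structure EpsAxiom (L : Signature) where
  F : Formula L
  t : Term L
  closed_eps : Closed (eps F)
  closed_t : Closed t

namespace EpsAxiom

variable {L : Signature}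

def formula (c : EpsAxiom L) : Formula L :=
  imp (inst c.t 0 c.F) (conj (neg (lt c.t (eps c.F))) (inst (eps c.F) 0 c.F))

/-- The canonical term `εx. |F|_S`. -/
noncomputable def critTerm (c : EpsAxiom L) (S : Subst L) : Term L := eps (S.reduce c.F)

/-- The value `|t|_S`. -/
noncomputable def critVal (c : EpsAxiom L) (S : Subst L) : ℕ := S.termVal c.t

end EpsAxiom

variable {L : Signature}

def Solving (Cr : List (EpsAxiom L)) (S : Subst L) : Prop := ∀ c ∈ Cr, S.Holds c.formula

/-- `rk(Cr)`, the largest rank of a formula in `Cr`. -/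
noncomputable def rkCr (Cr : List (EpsAxiom L)) : ℕ :=
  (Cr.map fun c => Expr.rk c.formula).foldr max 0

noncomputable def RANK (Cr : List (EpsAxiom L)) : ℕ := max (rkCr Cr + 1) 2

/-- The closed epsilon terms occurring in `Cr`. -/
def clEps (Cr : List (EpsAxiom L)) : Set (Term L) :=
  {e | (∃ F, e = eps F) ∧ Closed e ∧ ∃ c ∈ Cr, e ∈ subTerms c.formula}

/-- An enumeration `e_0, …, e_{N-1}` without repetitions of the closed epsilon terms occurring in
`Cr`, in which proper subterms of a term come later than the term. -/
structure Arrangement (Cr : List (EpsAxiom L)) where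
  N : ℕ
  e : Fin N → Term L
  injective : Function.Injective e
  range_eq : Set.range e = clEps Cr
  later : ∀ i j, e j ∈ subTerms (e i) → e j ≠ e i → i < j

/-- The order type of `x` in the ordering `1, 2, 3, …, 0` of the natural numbers: the nonzero
numbers in their usual order, followed by `0`. -/
noncomputable def ackType (x : ℕ) : Ordinal.{0} :=
  if x = 0 then Ordinal.omega0 else ((x - 1 : ℕ) : Ordinal.{0})

/-- The index `∑ (ω + 1)^i · ‖|e_i|_S‖`, summed in the order of decreasing `i`. -/
noncomputable def Arrangement.ind {Cr : List (EpsAxiom L)} (A : Arrangement Cr) (S : Subst L) :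
    Ordinal.{0} :=
  ((List.finRange A.N).reverse.map fun i : Fin A.N =>
    (Ordinal.omega0 + 1) ^ (i : ℕ) * ackType (S.termVal (A.e i))).sum

/-- A rule that associates to every nonsolving substitution `S` an axiom in `Cr` that is false
under `S`, in such a way that it depends only on the index of `S`. -/
structure Selection {Cr : List (EpsAxiom L)} (A : Arrangement Cr) where
  pick : Subst L → EpsAxiom L
  mem : ∀ S, ¬ Solving Cr S → pick S ∈ Cr
  false_pick : ∀ S, ¬ Solving Cr S → ¬ S.Holds (pick S).formula
  index_only : ∀ S T, ¬ Solving Cr S → ¬ Solving Cr T → A.ind S = A.ind T → pick S = pick T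

namespace Selection

variable {Cr : List (EpsAxiom L)} {A : Arrangement Cr}

open Classical in
/-- The H-process. It is constant once a solution is reached. -/
noncomputable def S (P : Selection A) : ℕ → Subst L
  | 0 => Subst.empty L
  | n + 1 =>
      if Solving Cr (P.S n) then P.S n
      else (P.S n).update ((P.pick (P.S n)).critTerm (P.S n)) ((P.pick (P.S n)).critVal (P.S n))
        ((P.S n).canonical_eps_reduce _ (P.pick (P.S n)).closed_eps)

open Classical in
/-- `r_n`, the rank of the `n`-th substitution up to and including the first solution, and
`0` afterwards. -/
noncomputable def r (P : Selection A) (n : ℕ) : ℕ :=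
  if ∀ m < n, ¬ Solving Cr (P.S m) then (P.S n).rk else 0

open Classical in
/-- `a_n`, the index of the `n`-th substitution up to and including the first solution, and
`0` afterwards. -/
noncomputable def a (P : Selection A) (n : ℕ) : Ordinal.{0} :=
  if ∀ m < n, ¬ Solving Cr (P.S m) then A.ind (P.S n) else 0

/-- The rank of the series `S^m, …, S^{k-1}`: the minimum of `RANK` and the `r_i`, `m < i < k`. -/
noncomputable def serRk (P : Selection A) (m k : ℕ) : ℕ :=
  ((Finset.Ioo m k).image P.r ∪ {RANK Cr}).min' ⟨RANK Cr, by simp⟩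

/-- The series `S^m, …, S^{k-1}` is a section. -/
def IsSection (P : Selection A) (m k : ℕ) : Prop := P.r m < P.serRk m k

/-- The starting points of the components in the decomposition of the series
`S^m, …, S^{k-1}`. -/
def nd (P : Selection A) (m k : ℕ) : Set ℕ := {n | m ≤ n ∧ n < k ∧ P.r n ≤ P.serRk n k}

/-- `S^i, …, S^{j-1}` is a component in the decomposition of `S^m, …, S^{k-1}`: `i` and `j` are
consecutive elements of `nd ∪ {k}`. -/
def IsComponent (P : Selection A) (m k i j : ℕ) : Prop :=
  i ∈ P.nd m k ∧ (j ∈ P.nd m k ∨ j = k) ∧ i < j ∧ ∀ n ∈ P.nd m k, ¬ (i < n ∧ n < j)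

/-- The series `S^m, …, S^{k-1}` is a `p`-series. -/
def IsPSeries (P : Selection A) : ℕ → ℕ → ℕ → Prop
  | 0, m, k => m < k ∧ P.r m ≤ P.serRk m k ∧ k = m + 1
  | p + 1, m, k => m < k ∧ P.r m ≤ P.serRk m k ∧
      ∀ i j, P.IsComponent m k i j → P.IsPSeries p i j ∧ P.IsSection i j

/-- The series `S^n, …, S^{k-1}` is a normal `p`-series. -/
def IsNormalPSeries (P : Selection A) (p n k : ℕ) : Prop :=
  P.IsPSeries p n k ∧ (n < k → ¬ Solving Cr (P.S (k - 1)))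

/-- The ordinal of a series, given as the list of its indices. `ordAux d` is the ordinal at level
`ξ = RANK - d`. At level `RANK` it is the index of the first substitution in the series. At a level
`ξ < RANK` the series is cut before each of its terms of rank `ξ` (other than the first), and its
ordinal is the sum of `2 ^ o`, in this order, for the ordinals `o` of the pieces at level
`ξ + 1`. -/
noncomputable def ordAux (P : Selection A) : ℕ → List ℕ → Ordinal.{0}
  | 0, l => (l.head?.map P.a).getD 0
  | d + 1, l =>
      ((l.splitBy fun _ j => decide (P.r j ≠ RANK Cr - (d + 1))).map
        fun c => (2 : Ordinal.{0}) ^ P.ordAux d c).sum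

/-- The ordinal of the series `S^m, …, S^{k-1}` at level `ξ ≤ RANK`. -/
noncomputable def ord (P : Selection A) (m k ξ : ℕ) : Ordinal.{0} :=
  P.ordAux (RANK Cr - ξ) (List.range' m (k - m))

open Classical in
/-- The function `n ↦ M(p + 1, n)`, given the function `Mp : n ↦ M(p, n)`. -/
noncomputable def nextM (P : Selection A) (Mp : ℕ → ℕ) (n : ℕ) : ℕ :=
  if Solving Cr (P.S n) then n
  else if P.ord (Mp n) (Mp (Mp n)) 0 < P.ord n (Mp n) 0 then
    if P.r (Mp n) < P.r n then Mp n else P.nextM Mp (Mp n)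
  else Mp n
termination_by P.ord n (Mp n) 0

/-- `M(p, n)`. -/
noncomputable def M (P : Selection A) : ℕ → ℕ → ℕ
  | 0, n => n + 1
  | p + 1, n => P.nextM (P.M p) n

end Selection

end EpsPA

/-!
The proof rests on three observations.

*Better values, smaller index.* Under every substitution of the process a value `u ≠ 0` of a
canonical term `εx. G` is justified: `G[u]` is true and `G[0]` is false (`Subst.Correct`). Hence the
value proposed by a false axiom is nonzero, and smaller than the current value if that is nonzero.
So, if nothing else is changed, the index decreases, unless no axiom notices the change; in the
latter case the next axiom chosen, its term and its value are the same as without the change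
(`Arrangement.ind_lt_or_termVal_eq`).

*Ackermann's comparison.* Let `i < k`, with the rank at `i` at most that at `k`, and the latter
smaller than the ranks between them. Then `S^k` is `S^i` with one value improved, and the process
repeats from `S^k` on what it did from `S^i` on, until the index becomes smaller
(`Selection.exists_a_lt`). This happens before the repetition reaches the counterpart of `S^k`,
because the axiom used at `S^{k-1}` has become true. By induction on the length of the second
series, its ordinal is at each level a sum of decreasing powers of `2`. Such a sum is in normal
form, so that ordinals of series are compared at the first place where the series differ
(`Selection.serOrd_lt_serOrd`). Hence if `n < k < l` and no rank in between `k` and `l` is below the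
rank at `k`, which is itself at least that at `n`, then the series from `k` to `l` has a smaller
ordinal than the one from `n` to `k` (`Selection.ord_lt_ord`). In particular, as long as the ranks
allow it, the recursion that defines `M (p + 1)` continues.

*Combinatorics of `p`-series.* A series whose first rank is minimal is a `p`-series if and only if
it does not contain, after its first term, a chain of `p` successive steps to the next place of
smaller rank (`Selection.isPSeries_iff`). This shows that a `p`-series followed by a
`(p + 1)`-series of no smaller initial rank is a `(p + 1)`-series, that a `(p + 1)`-series is again
one after removal of a maximal initial `p`-series, and, since the ranks after the first one lie
strictly between `0` and `RANK`, that each initial part of the process without a solution is a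
`(RANK - 1)`-series. The first two facts give the correctness and the maximality of `M`; by
maximality, the third one excludes that `M (RANK - 1) 0` comes before the first solution.
-/

namespace EpsPA

open EpsPA.Expr

namespace Expr

variable {L : Signature}

/-! ### Ranks, subterms and instances of expressions -/

theorem rkAt_eq_zero_of_not_occurs {k : Kind} (e : Expr L k) (i : ℕ) (h : ¬ Occurs i e) :
    rkAt i e = 0 := by
  induction e generalizing i with
  | var j => rfl
  | num n => rfl
  | fn f a ih =>
    simp only [Occurs, not_exists] at h
    simp only [rkAt, ← Nat.bot_eq_zero, Finset.sup_eq_bot_iff]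
    exact fun c _ => ih c i (h c)
  | eps F ih =>
    simp only [Occurs] at h
    simp [rkAt, h, ih _ h]
  | neg A ih => exact ih i h
  | _ _ _ ih1 ih2 =>
    simp only [Occurs, not_or] at h
    simp [rkAt, ih1 i h.1, ih2 i h.2]

theorem mem_subTerms_self (t : Term L) : t ∈ subTerms t := by
  cases t <;> simp [subTerms]

theorem subTerms_trans {k : Kind} (e : Expr L k) (s t : Term L) (ht : t ∈ subTerms e)
    (hs : s ∈ subTerms t) : s ∈ subTerms e := by
  induction e with
  | var j => simp only [subTerms, Set.mem_singleton_iff] at ht; subst ht; exact hs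
  | num n => simp only [subTerms, Set.mem_singleton_iff] at ht; subst ht; exact hs
  | fn f a ih =>
    simp only [subTerms, Set.mem_insert_iff, Set.mem_iUnion] at ht
    rcases ht with rfl | ⟨c, hc⟩
    · exact hs
    · exact Or.inr (Set.mem_iUnion.2 ⟨c, ih c hc⟩)
  | eps F ih =>
    simp only [subTerms, Set.mem_insert_iff] at ht
    rcases ht with rfl | ht
    · exact hs
    · exact Or.inr (ih ht)
  | neg A ih => exact ih ht
  | _ _ _ ih1 ih2 => exact ht.elim (fun h => Or.inl (ih1 h)) (fun h => Or.inr (ih2 h))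

/-- If every closed term occurring in `e` is a numeral, then the rank of `e` is attained at an
`ε`-term with a variable that is free in `e`: an `ε`-term of largest rank has a free variable, and
an `ε`-term binding this variable would have larger rank. -/
theorem exists_rk_le_rkAt {k : Kind} (e : Expr L k)
    (h : ∀ t ∈ subTerms e, Closed t → IsNum t) : rk e = 0 ∨ ∃ i, rk e ≤ rkAt i e := by
  induction e with
  | var j => exact Or.inl rfl
  | num n => exact Or.inl rfl
  | fn f a ih =>
    rcases (Finset.univ : Finset (Fin (L.arity f))).eq_empty_or_nonempty with h0 | h0
    · exact Or.inl (by simp [rk, h0])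
    · obtain ⟨c, -, hc⟩ := Finset.exists_mem_eq_sup _ h0 (fun c => rk (a c))
      rcases ih c (fun t ht => h t (Or.inr (Set.mem_iUnion.2 ⟨c, ht⟩))) with h1 | ⟨i, hi⟩
      · exact Or.inl (by rw [rk, hc, h1])
      · refine Or.inr ⟨i, ?_⟩
        rw [rk, hc]
        exact hi.trans (Finset.le_sup (f := fun c => rkAt i (a c)) (Finset.mem_univ c))
  | eps F ih =>
    right
    have hn : ¬ Closed (eps F) := fun hc => by
      obtain ⟨n, hn⟩ := h _ (mem_subTerms_self _) hc
      cases hn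
    simp only [Closed, not_forall, not_not] at hn
    obtain ⟨j, hj⟩ := hn
    have hj' : Occurs (j + 1) F := hj
    have hle : rkAt 0 F + 1 ≤ rkAt j (eps F) := by simp [rkAt, hj']
    rcases ih (fun t ht => h t (Or.inr ht)) with h1 | ⟨i, hi⟩
    · exact ⟨j, by rw [rk, h1]; omega⟩
    · cases i with
      | zero => exact ⟨j, by rw [rk]; omega⟩
      | succ i =>
        have h2 : rkAt (i + 1) F ≤ rkAt i (eps F) := by simp [rkAt]
        rcases le_total (rkAt 0 F + 1) (rk F) with h3 | h3
        · exact ⟨i, by rw [rk]; omega⟩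
        · exact ⟨j, by rw [rk]; omega⟩
  | neg A ih => exact ih h
  | _ _ _ ih1 ih2 =>
    have h1 := ih1 (fun t ht => h t (Or.inl ht))
    have h2 := ih2 (fun t ht => h t (Or.inr ht))
    simp only [rk, rkAt]
    rcases h1 with h1 | ⟨i, hi⟩ <;> rcases h2 with h2 | ⟨j, hj⟩
    · exact Or.inl (by omega)
    · exact Or.inr ⟨j, by omega⟩
    · exact Or.inr ⟨i, by omega⟩
    · rename_i A B
      rcases le_total (rk A) (rk B) with h3 | h3
      · exact Or.inr ⟨j, by omega⟩
      · exact Or.inr ⟨i, by omega⟩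

/-- The matrix of a canonical term has smaller rank than the term itself. -/
theorem Canonical.rk_lt {F : Formula L} (h : Canonical (eps F)) : rk F < rk (eps F) := by
  obtain ⟨G, hG, hc, hn⟩ := h
  obtain rfl : F = G := by injection hG
  have key : rk F ≤ rkAt 0 F := by
    rcases exists_rk_le_rkAt F hn with h1 | ⟨i, hi⟩
    · omega
    · cases i with
      | zero => exact hi
      | succ i =>
        have := rkAt_eq_zero_of_not_occurs F (i + 1) (hc i)
        omega
  simp only [rk]
  omega

theorem occurs_of_occurs_inst_num {k : Kind} (e : Expr L k) (n i j : ℕ)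
    (h : Occurs j (inst (num n) i e)) : Occurs j e := by
  induction e generalizing i j with
  | var l =>
    simp only [inst] at h
    split_ifs at h
    · exact h.elim
    · exact h
  | num n => exact h
  | fn f a ih => exact h.imp fun c hc => ih c i j hc
  | eps F ih => exact ih (i + 1) (j + 1) h
  | neg A ih => exact ih i j h
  | _ _ _ ih1 ih2 => exact h.imp (ih1 i j) (ih2 i j)

theorem rkAt_inst_num_le {k : Kind} (e : Expr L k) (n i j : ℕ) :
    rkAt j (inst (num n) i e) ≤ rkAt j e := by
  induction e generalizing i j with
  | var l => simp only [inst]; split_ifs <;> simp [rkAt]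
  | num n => exact le_rfl
  | fn f a ih => exact Finset.sup_mono_fun fun c _ => ih c i j
  | eps F ih =>
    refine max_le_max ?_ (ih (i + 1) (j + 1))
    split_ifs with h1 h2
    · exact Nat.succ_le_succ (ih (i + 1) 0)
    · exact absurd (occurs_of_occurs_inst_num F n (i + 1) (j + 1) h1) h2
    · exact Nat.zero_le _
    · exact le_rfl
  | neg A ih => exact ih i j
  | _ _ _ ih1 ih2 => exact max_le_max (ih1 i j) (ih2 i j)

theorem rk_inst_num_le {k : Kind} (e : Expr L k) (n i : ℕ) :
    rk (inst (num n) i e) ≤ rk e := by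
  induction e generalizing i with
  | var l => simp only [inst]; split_ifs <;> simp [rk]
  | num n => exact le_rfl
  | fn f a ih => exact Finset.sup_mono_fun fun c _ => ih c i
  | eps F ih => exact max_le_max (Nat.succ_le_succ (rkAt_inst_num_le F n (i + 1) 0)) (ih (i + 1))
  | neg A ih => exact ih i
  | _ _ _ ih1 ih2 => exact max_le_max (ih1 i) (ih2 i)

theorem inst_eq_of_not_occurs {k : Kind} (e : Expr L k) (t : Term L) (i : ℕ)
    (h : ¬ Occurs i e) : inst t i e = e := by
  induction e generalizing i with
  | var l =>
    have : ¬ l = i := fun hl => h hl.symm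
    simp [inst, this]
  | num n => rfl
  | fn f a ih =>
    simp only [inst]
    congr 1
    funext c
    exact ih c i fun hc => h ⟨c, hc⟩
  | eps F ih => simp only [inst]; rw [ih (i + 1) h]
  | neg A ih => simp only [inst]; rw [ih i h]
  | _ _ _ ih1 ih2 =>
    simp only [Occurs, not_or] at h
    simp only [inst]; rw [ih1 i h.1, ih2 i h.2]

/-- Truth of a reduced formula: the atoms are compared by the values of their sides as
numerals. -/
def Truth : Formula L → Prop
  | eq s t => numVal s = numVal t
  | lt s t => numVal s < numVal t
  | neg A => ¬ Truth A
  | conj A B => Truth A ∧ Truth B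
  | disj A B => Truth A ∨ Truth B
  | imp A B => Truth A → Truth B

end Expr

namespace Subst

variable {L : Signature}

/-! ### Irreducible forms -/

theorem reduce_num (S : Subst L) (n : ℕ) : S.reduce (num n : Term L) = num n := by
  rw [reduce]

theorem rkAt_reduce_le (S : Subst L) {k : Kind} (e : Expr L k) (i : ℕ) :
    rkAt i (S.reduce e) ≤ rkAt i e := by
  induction e generalizing i with
  | var j => exact le_of_eq (by rw [reduce])
  | num n => exact le_of_eq (by rw [reduce])
  | fn f a ih =>
    rw [reduce]
    split_ifs with h
    · exact Nat.zero_le _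
    · exact Finset.sup_mono_fun fun c _ => ih c i
  | eps F ih =>
    rw [reduce]
    split_ifs with h
    · exact Nat.zero_le _
    · simp only [rkAt]
      refine max_le_max ?_ (ih (i + 1))
      by_cases hF : Occurs (i + 1) F
      · rw [if_pos hF, if_pos ((S.occurs_reduce F _).2 hF)]
        exact Nat.succ_le_succ (ih 0)
      · rw [if_neg hF, if_neg (mt (S.occurs_reduce F _).1 hF)]
  | neg A ih => rw [reduce]; exact ih i
  | _ _ _ ih1 ih2 => rw [reduce]; exact max_le_max (ih1 i) (ih2 i)

theorem rk_reduce_le (S : Subst L) {k : Kind} (e : Expr L k) :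
    Expr.rk (S.reduce e) ≤ Expr.rk e := by
  induction e with
  | var j => exact le_of_eq (by rw [reduce])
  | num n => exact le_of_eq (by rw [reduce])
  | fn f a ih =>
    rw [reduce]
    split_ifs with h
    · exact Nat.zero_le _
    · exact Finset.sup_mono_fun fun c _ => ih c
  | eps F ih =>
    rw [reduce]
    split_ifs with h
    · exact Nat.zero_le _
    · exact max_le_max (Nat.succ_le_succ (S.rkAt_reduce_le F 0)) ih
  | neg A ih => rw [reduce]; exact ih
  | _ _ _ ih1 ih2 => rw [reduce]; exact max_le_max ih1 ih2

theorem rk_eps_reduce_le (S : Subst L) (F : Formula L) :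
    Expr.rk (eps (S.reduce F)) ≤ Expr.rk (eps F) :=
  max_le_max (Nat.succ_le_succ (S.rkAt_reduce_le F 0)) (S.rk_reduce_le F)

theorem closed_eps_reduce_iff (S : Subst L) (F : Formula L) :
    Closed (eps (S.reduce F)) ↔ Closed (eps F) :=
  forall_congr' fun i => not_congr (S.occurs_reduce F (i + 1))

theorem reduce_eps_of_closed (S : Subst L) {F : Formula L} (h : Closed (eps F)) :
    S.reduce (eps F) = num ((S.val (eps (S.reduce F))).getD 0) := by
  rw [reduce, if_pos ((S.closed_eps_reduce_iff F).2 h)]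

theorem reduce_eq_num_of_closed (S : Subst L) {t : Term L} (h : Closed t) :
    S.reduce t = num (S.termVal t) := by
  obtain ⟨n, hn⟩ := S.isNum_of_mem_reduce t _ (mem_subTerms_self _)
    (fun i hi => h i ((S.occurs_reduce t i).1 hi))
  rw [termVal, hn, numVal]

theorem reduce_fn_congr {S T : Subst L} {f : L.Fn} {a b : Fin (L.arity f) → Term L}
    (h : ∀ c, S.reduce (a c) = T.reduce (b c)) : S.reduce (fn f a) = T.reduce (fn f b) := by
  have h' : (∀ c, IsNum (S.reduce (a c))) ↔ ∀ c, IsNum (T.reduce (b c)) := by simp only [h]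
  rw [reduce, reduce]
  by_cases hn : ∀ c, IsNum (T.reduce (b c))
  · rw [if_pos hn, if_pos (h'.2 hn)]
    simp only [h]
  · rw [if_neg hn, if_neg (mt h'.1 hn)]
    simp only [h]

/-- The irreducible form of an expression of rank `≤ ρ` depends only on the values of terms of
rank `≤ ρ`. -/
theorem reduce_congr_of_rk_le {S T : Subst L} {ρ : ℕ}
    (h : ∀ f, Expr.rk f ≤ ρ → S.val f = T.val f) {k : Kind} (e : Expr L k)
    (he : Expr.rk e ≤ ρ) : S.reduce e = T.reduce e := by
  induction e with
  | var j => rw [reduce, reduce]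
  | num n => rw [reduce, reduce]
  | fn f a ih =>
    have : ∀ c, S.reduce (a c) = T.reduce (a c) := fun c =>
      ih c ((Finset.le_sup (f := fun c => Expr.rk (a c)) (Finset.mem_univ c)).trans he)
    exact reduce_fn_congr this
  | eps F ih =>
    have hF : S.reduce F = T.reduce F := ih ((le_max_right _ _).trans he)
    rw [reduce, reduce, hF, h _ ((T.rk_eps_reduce_le F).trans he)]
  | neg A ih => rw [reduce, reduce, ih he]
  | _ _ _ ih1 ih2 =>
    rw [reduce, reduce, ih1 ((le_max_left _ _).trans he), ih2 ((le_max_right _ _).trans he)]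

/-- The irreducible form of an expression depends only on the values of the closed `ε`-terms
occurring in it. -/
theorem reduce_congr_of_termVal_eq {S T : Subst L} {k : Kind} (e : Expr L k)
    (h : ∀ F, eps F ∈ subTerms e → Closed (eps F) → S.termVal (eps F) = T.termVal (eps F)) :
    S.reduce e = T.reduce e := by
  induction e with
  | var j => rw [reduce, reduce]
  | num n => rw [reduce, reduce]
  | fn f a ih =>
    have : ∀ c, S.reduce (a c) = T.reduce (a c) := fun c =>
      ih c fun F hF => h F (Or.inr (Set.mem_iUnion.2 ⟨c, hF⟩))
    exact reduce_fn_congr this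
  | eps F ih =>
    by_cases hc : Closed (eps F)
    · rw [S.reduce_eq_num_of_closed hc, T.reduce_eq_num_of_closed hc,
        h F (mem_subTerms_self _) hc]
    · have hF : S.reduce F = T.reduce F := ih fun G hG => h G (Or.inr hG)
      rw [reduce, reduce, if_neg (mt (S.closed_eps_reduce_iff F).1 hc),
        if_neg (mt (T.closed_eps_reduce_iff F).1 hc), hF]
  | neg A ih => rw [reduce, reduce, ih h]
  | _ _ _ ih1 ih2 =>
    rw [reduce, reduce, ih1 fun F hF => h F (Or.inl hF), ih2 fun F hF => h F (Or.inr hF)]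

/-- Reduction commutes with the substitution of a closed term. -/
theorem reduce_inst (S : Subst L) {t : Term L} (ht : Closed t) {k : Kind} (e : Expr L k) (i : ℕ) :
    S.reduce (inst t i e) = S.reduce (inst (num (S.termVal t)) i (S.reduce e)) := by
  induction e generalizing i with
  | var j =>
    have h1 : S.reduce (var j : Term L) = var j := by rw [reduce]
    rw [h1]
    simp only [inst]
    split_ifs with h
    · rw [S.reduce_eq_num_of_closed ht, reduce]
    · rfl
  | num n => rw [S.reduce_num]; rfl
  | fn f a ih =>
    by_cases h : ∀ c, IsNum (S.reduce (a c))
    · rw [show S.reduce (fn f a) = num (L.interp f fun c => numVal (S.reduce (a c))) by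
        rw [reduce, if_pos h]]
      have h2 : ∀ c, S.reduce (inst t i (a c)) = S.reduce (a c) := fun c => by
        obtain ⟨m, hm⟩ := h c
        rw [ih c i, hm]
        simp only [inst]
        rw [reduce]
      simp only [inst]
      rw [reduce_fn_congr h2, reduce_num, reduce, if_pos h]
    · rw [show S.reduce (fn f a) = fn f fun c => S.reduce (a c) by rw [reduce, if_neg h]]
      exact reduce_fn_congr fun c => ih c i
  | eps F ih =>
    by_cases hc : Closed (eps F)
    · rw [inst_eq_of_not_occurs _ t i (hc i), S.reduce_eps_of_closed hc]
      simp only [inst]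
      rw [reduce]
    · rw [show S.reduce (eps F) = eps (S.reduce F) by
        rw [reduce, if_neg (mt (S.closed_eps_reduce_iff F).1 hc)]]
      simp only [inst]
      rw [reduce, reduce, ih (i + 1)]
  | neg A ih => simp only [inst, reduce]; rw [ih i]
  | _ _ _ ih1 ih2 => simp only [inst, reduce]; rw [ih1 i, ih2 i]

theorem holds_iff_truth_reduce (S : Subst L) :
    ∀ A : Formula L, S.Holds A ↔ Truth (S.reduce A)
  | eq s t => by rw [reduce, Holds, Truth]; exact Iff.rfl
  | lt s t => by rw [reduce, Holds, Truth]; exact Iff.rfl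
  | neg A => by rw [reduce, Holds, Truth, holds_iff_truth_reduce S A]
  | conj A B => by
    rw [reduce, Holds, Truth, holds_iff_truth_reduce S A, holds_iff_truth_reduce S B]
  | disj A B => by
    rw [reduce, Holds, Truth, holds_iff_truth_reduce S A, holds_iff_truth_reduce S B]
  | imp A B => by
    rw [reduce, Holds, Truth, holds_iff_truth_reduce S A, holds_iff_truth_reduce S B]

theorem holds_congr {S T : Subst L} {A B : Formula L} (h : S.reduce A = T.reduce B) :
    S.Holds A ↔ T.Holds B := by
  rw [holds_iff_truth_reduce, holds_iff_truth_reduce, h]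

theorem update_val_self (S : Subst L) (e : Term L) (v : ℕ) (he : Canonical e) :
    (S.update e v he).val e = some v := by
  simp [update]

theorem update_val_of_rk_le (S : Subst L) {e f : Term L} (v : ℕ) (he : Canonical e)
    (hf : f ≠ e) (h : Expr.rk f ≤ Expr.rk e) : (S.update e v he).val f = S.val f := by
  simp [update, hf, h]

theorem update_val_of_lt_rk (S : Subst L) {e f : Term L} (v : ℕ) (he : Canonical e)
    (h : Expr.rk e < Expr.rk f) : (S.update e v he).val f = none := by
  have : f ≠ e := by rintro rfl; omega
  simp [update, this, h]

theorem rk_update (S : Subst L) (e : Term L) (v : ℕ) (he : Canonical e) :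
    (S.update e v he).rk = Expr.rk e := by
  apply le_antisymm
  · refine Finset.sup_le fun f hf => ?_
    rw [Set.Finite.mem_toFinset] at hf
    by_contra h
    exact hf (S.update_val_of_lt_rk v he (not_le.1 h))
  · refine Finset.le_sup (f := Expr.rk) ?_
    rw [Set.Finite.mem_toFinset]
    simp [update_val_self]

theorem val_eq_none_of_rk_lt (S : Subst L) {f : Term L} (h : S.rk < Expr.rk f) :
    S.val f = none := by
  by_contra hf
  have : Expr.rk f ≤ S.rk := Finset.le_sup (f := Expr.rk) ((Set.Finite.mem_toFinset _).2 hf)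
  omega

end Subst

/-! ### Values proposed by false axioms -/

theorem ackType_lt_ackType {x y : ℕ} (hx : x ≠ 0) (h : y = 0 ∨ x < y) : ackType x < ackType y := by
  rw [ackType, if_neg hx, ackType]
  split_ifs with hy
  · exact Ordinal.natCast_lt_omega0 _
  · rw [Nat.cast_lt]
    omega

theorem ackType_le_omega0 (x : ℕ) : ackType x ≤ Ordinal.omega0 := by
  rw [ackType]
  split_ifs
  · exact le_rfl
  · exact (Ordinal.natCast_lt_omega0 _).le

variable {L : Signature}

namespace Expr

/-- The height of the syntax tree. -/
def height : {k : Kind} → Expr L k → ℕ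
  | _, var _ => 0
  | _, num _ => 0
  | _, fn _ a => Finset.univ.sup (fun c => height (a c)) + 1
  | _, eps F => height F + 1
  | _, eq s t => max (height s) (height t)
  | _, lt s t => max (height s) (height t)
  | _, neg A => height A
  | _, conj A B => max (height A) (height B)
  | _, disj A B => max (height A) (height B)
  | _, imp A B => max (height A) (height B)

theorem height_le_of_mem_subTerms {k : Kind} (e : Expr L k) {t : Term L} (h : t ∈ subTerms e) :
    height t ≤ height e := by
  induction e with
  | var j => simp only [subTerms, Set.mem_singleton_iff] at h; rw [h]
  | num n => simp only [subTerms, Set.mem_singleton_iff] at h; rw [h]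
  | fn f a ih =>
    simp only [subTerms, Set.mem_insert_iff, Set.mem_iUnion] at h
    rcases h with rfl | ⟨c, hc⟩
    · exact le_rfl
    · exact (ih c hc).trans
        ((Finset.le_sup (f := fun c => height (a c)) (Finset.mem_univ c)).trans (Nat.le_succ _))
  | eps F ih =>
    simp only [subTerms, Set.mem_insert_iff] at h
    rcases h with rfl | h
    · exact le_rfl
    · exact (ih h).trans (Nat.le_succ _)
  | neg A ih => exact ih h
  | _ _ _ ih1 ih2 =>
    exact h.elim (fun h => (ih1 h).trans (le_max_left _ _))
      (fun h => (ih2 h).trans (le_max_right _ _))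

theorem eps_notMem_subTerms (F : Formula L) : eps F ∉ subTerms F := fun h => by
  have := height_le_of_mem_subTerms F h
  simp only [height] at this
  omega

end Expr

namespace Subst

theorem termVal_eps (S : Subst L) {F : Formula L} (h : Closed (eps F)) :
    S.termVal (eps F) = (S.val (eps (S.reduce F))).getD 0 := by
  rw [termVal, S.reduce_eps_of_closed h, numVal]

theorem holds_inst (S : Subst L) {t : Term L} (ht : Closed t) (F : Formula L) :
    S.Holds (inst t 0 F) ↔ S.Holds (inst (num (S.termVal t)) 0 (S.reduce F)) :=
  holds_congr (S.reduce_inst ht F 0)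

/-- Every value `u` that `S` gives to a term `εx. G` is justified: `G[u]` is true under `S`, while
the default value would be wrong, as `G[0]` is false. -/
def Correct (S : Subst L) : Prop :=
  ∀ G u, S.val (eps G) = some u → S.Holds (inst (num u) 0 G) ∧ ¬ S.Holds (inst (num 0) 0 G)

end Subst

namespace EpsAxiom

theorem holds_of_not_holds_formula (c : EpsAxiom L) (S : Subst L) (h : ¬ S.Holds c.formula) :
    S.Holds (inst (num (c.critVal S)) 0 (S.reduce c.F)) ∧
      (c.critVal S < (S.val (c.critTerm S)).getD 0 ∨
        ¬ S.Holds (inst (num ((S.val (c.critTerm S)).getD 0)) 0 (S.reduce c.F))) := by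
  have h1 := S.termVal_eps c.closed_eps
  simp only [formula, Subst.Holds, S.holds_inst c.closed_t, S.holds_inst c.closed_eps, h1] at h
  simp only [critVal, critTerm]
  tauto

theorem canonical_critTerm (c : EpsAxiom L) (S : Subst L) : Canonical (c.critTerm S) :=
  S.canonical_eps_reduce c.F c.closed_eps

/-- The value proposed by an axiom that is false under a correct substitution is nonzero, and
smaller than the current value if this is nonzero. -/
theorem ackType_critVal_lt (c : EpsAxiom L) {S : Subst L} (hS : S.Correct)
    (h : ¬ S.Holds c.formula) :
    ackType (c.critVal S) < ackType ((S.val (c.critTerm S)).getD 0) := by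
  obtain ⟨h1, h2⟩ := c.holds_of_not_holds_formula S h
  cases hv : S.val (c.critTerm S) with
  | none =>
    rw [hv] at h2
    simp only [Option.getD_none, not_lt_zero, false_or] at h2
    refine ackType_lt_ackType (fun h0 => h2 ?_) (Or.inl rfl)
    rwa [h0] at h1
  | some u =>
    rw [hv] at h2
    obtain ⟨h3, h4⟩ := hS _ _ hv
    simp only [Option.getD_some] at h2 ⊢
    refine ackType_lt_ackType (fun h0 => h4 ?_) (Or.inr (h2.resolve_right (not_not.2 h3)))
    rwa [h0] at h1

end EpsAxiom

namespace Subst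

theorem Correct.update {S : Subst L} (hS : S.Correct) (c : EpsAxiom L)
    (h : ¬ S.Holds c.formula) :
    (S.update (c.critTerm S) (c.critVal S) (c.canonical_critTerm S)).Correct := by
  set e := c.critTerm S with he
  set T := S.update e (c.critVal S) (c.canonical_critTerm S) with hT
  -- The truth of an instance of the matrix of `εx. G` involves only terms of rank less than the
  -- rank of `εx. G`, and these have not been changed.
  have key : ∀ G n, Canonical (eps G) → Expr.rk (eps G) ≤ Expr.rk e →
      (T.Holds (inst (num n) 0 G) ↔ S.Holds (inst (num n) 0 G)) := by
    intro G n hG hr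
    refine holds_congr (reduce_congr_of_rk_le (ρ := Expr.rk G) (fun f hf => ?_) _
      (rk_inst_num_le G n 0))
    have h1 := hG.rk_lt
    exact S.update_val_of_rk_le _ _ (by rintro rfl; omega) (by omega)
  intro G u hu
  have hG : Canonical (eps G) := T.canonical _ (by simp [hu])
  by_cases hr : Expr.rk (eps G) ≤ Expr.rk e
  · rw [key G u hG hr, key G 0 hG hr]
    by_cases hGe : eps G = e
    · obtain rfl : G = S.reduce c.F := by
        rw [he, EpsAxiom.critTerm] at hGe
        injection hGe
      rw [hGe, hT, update_val_self, Option.some.injEq] at hu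
      obtain ⟨h1, h2⟩ := c.holds_of_not_holds_formula S h
      rw [← hu]
      refine ⟨h1, ?_⟩
      cases hv : S.val e with
      | none =>
        rw [hv] at h2
        simpa using h2
      | some w => exact (hS _ _ hv).2
    · rw [hT, S.update_val_of_rk_le _ _ hGe hr] at hu
      exact hS G u hu
  · rw [hT, S.update_val_of_lt_rk _ _ (not_le.1 hr)] at hu
    cases hu

end Subst

/-! ### The index of a substitution -/

section Index

open Ordinal

/-- Sums `∑ (ω + 1)^i · g i` with coefficients at most `ω`, taken in decreasing order of `i`, are
bounded by the next power of `ω + 1`. -/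
theorem sum_opow_lt {n : ℕ} (g : Fin n → Ordinal.{0}) (hg : ∀ i, g i ≤ ω) :
    ((List.finRange n).reverse.map fun i : Fin n => (ω + 1) ^ (i : ℕ) * g i).sum
      < (ω + 1) ^ n := by
  induction n with
  | zero => simp
  | succ n ih =>
    have h1 := ih (fun i => g i.castSucc) fun i => hg _
    rw [List.finRange_succ_last, List.reverse_append, List.reverse_singleton, List.singleton_append,
      List.map_cons, List.sum_cons, ← List.map_reverse, List.map_map]
    refine (add_lt_add_right (a := (ω + 1) ^ (Fin.last n : ℕ) * g (Fin.last n)) h1).trans_le ?_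
    rw [Fin.val_last, pow_succ, ← mul_add_one]
    exact mul_le_mul_right (add_le_add_left (hg _) 1) _

/-- Sums `∑ (ω + 1)^i · g i` with coefficients at most `ω`, taken in decreasing order of `i`, are
compared lexicographically. -/
theorem sum_opow_lt_sum_opow {n : ℕ} (g g' : Fin n → Ordinal.{0}) (hg : ∀ i, g' i ≤ ω)
    (p : Fin n) (hp : g' p < g p) (hq : ∀ q, p < q → g' q = g q) :
    ((List.finRange n).reverse.map fun i : Fin n => (ω + 1) ^ (i : ℕ) * g' i).sum
      < ((List.finRange n).reverse.map fun i : Fin n => (ω + 1) ^ (i : ℕ) * g i).sum := by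
  induction n with
  | zero => exact p.elim0
  | succ n ih =>
    rw [List.finRange_succ_last, List.reverse_append, List.reverse_singleton, List.singleton_append,
      List.map_cons, List.sum_cons, ← List.map_reverse, List.map_map, List.map_cons, List.sum_cons,
      List.map_map]
    induction p using Fin.lastCases with
    | last =>
      have h1 := sum_opow_lt (fun i => g' i.castSucc) fun i => hg _
      refine (add_lt_add_right (a := (ω + 1) ^ (Fin.last n : ℕ) * g' (Fin.last n)) h1).trans_le
        (le_trans ?_ (le_self_add (a := (ω + 1) ^ (Fin.last n : ℕ) * g (Fin.last n))))
      rw [Fin.val_last, ← mul_add_one]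
      exact mul_le_mul_right (Order.add_one_le_of_lt hp) _
    | cast p =>
      rw [hq _ (Fin.castSucc_lt_last p)]
      exact add_lt_add_right (ih (fun i => g i.castSucc) (fun i => g' i.castSucc) (fun i => hg _) p
        hp fun q hpq => hq _ (Fin.castSucc_lt_castSucc_iff.2 hpq)) _

end Index

variable {Cr : List (EpsAxiom L)}

theorem eps_mem_clEps {c : EpsAxiom L} (hc : c ∈ Cr) {F : Formula L}
    (h : eps F ∈ subTerms c.formula) (hF : Closed (eps F)) : eps F ∈ clEps Cr :=
  ⟨⟨F, rfl⟩, hF, c, hc, h⟩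

theorem clEps_of_mem_subTerms {t : Term L} (ht : t ∈ clEps Cr) {F : Formula L}
    (h : eps F ∈ subTerms t) (hF : Closed (eps F)) : eps F ∈ clEps Cr := by
  obtain ⟨-, -, c, hc, htc⟩ := ht
  exact eps_mem_clEps hc (subTerms_trans _ _ _ htc h) hF

/-- If only the value of `e` is changed, and for the better, then either the index decreases, or
the change is not noticed by the axioms. -/
theorem Arrangement.ind_lt_or_termVal_eq (A : Arrangement Cr) {S T : Subst L} {e : Term L}
    (hne : ∀ f, f ≠ e → T.val f = S.val f)
    (hlt : ackType ((T.val e).getD 0) < ackType ((S.val e).getD 0)) :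
    A.ind T < A.ind S ∨ A.ind T = A.ind S ∧ ∀ t ∈ clEps Cr, T.termVal t = S.termVal t := by
  by_cases hall : ∀ i, T.termVal (A.e i) = S.termVal (A.e i)
  · refine Or.inr ⟨by simp only [ind, hall], fun t ht => ?_⟩
    rw [← A.range_eq] at ht
    obtain ⟨i, rfl⟩ := ht
    exact hall i
  left
  obtain ⟨i, hi⟩ := not_forall.1 hall
  -- `p` is the last, hence innermost, term of the enumeration whose value changes
  obtain ⟨p, hp, hmax⟩ := (Finset.univ.filter fun i =>
    T.termVal (A.e i) ≠ S.termVal (A.e i)).exists_max_image id ⟨i, by simpa using hi⟩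
  simp only [Finset.mem_filter, Finset.mem_univ, true_and, id] at hp hmax
  have hlater : ∀ q, p < q → T.termVal (A.e q) = S.termVal (A.e q) := fun q hq => by
    by_contra h
    exact absurd (hmax q h) (not_le.2 hq)
  have hcl : A.e p ∈ clEps Cr := A.range_eq ▸ Set.mem_range_self p
  obtain ⟨⟨F, hF⟩, hclosed, -⟩ := id hcl
  have hred : T.reduce F = S.reduce F := by
    refine Subst.reduce_congr_of_termVal_eq F fun G hG hGc => ?_
    have hGp : eps G ∈ subTerms (A.e p) := by rw [hF]; exact Or.inr hG
    have hGcl := clEps_of_mem_subTerms hcl hGp hGc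
    rw [← A.range_eq] at hGcl
    obtain ⟨q, hq⟩ := hGcl
    rw [← hq] at hGp hG ⊢
    refine hlater q (A.later p q hGp fun hqp => eps_notMem_subTerms F ?_)
    rwa [hqp, hF] at hG
  rw [hF] at hclosed
  have hT := T.termVal_eps hclosed
  have hS := S.termVal_eps hclosed
  have hGe : eps (S.reduce F) = e := by
    by_contra h
    rw [hred, hne _ h, ← hS, ← hF] at hT
    exact hp hT
  rw [hred, hGe, ← hF] at hT
  rw [hGe, ← hF] at hS
  refine sum_opow_lt_sum_opow _ _ (fun i => ackType_le_omega0 _) p ?_ fun q hq => by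
    rw [hlater q hq]
  rwa [hT, hS]

section Agree

variable {S T : Subst L}

theorem reduce_formula_congr (h : ∀ t ∈ clEps Cr, T.termVal t = S.termVal t) {c : EpsAxiom L}
    (hc : c ∈ Cr) : T.reduce c.formula = S.reduce c.formula :=
  Subst.reduce_congr_of_termVal_eq _ fun _ hF hFc => h _ (eps_mem_clEps hc hF hFc)

theorem solving_congr (h : ∀ t ∈ clEps Cr, T.termVal t = S.termVal t) :
    Solving Cr T ↔ Solving Cr S :=
  forall₂_congr fun _ hc => Subst.holds_congr (reduce_formula_congr h hc)

theorem eps_mem_subTerms_formula (c : EpsAxiom L) : eps c.F ∈ subTerms c.formula :=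
  Or.inr (Or.inl (Or.inr (mem_subTerms_self _)))

theorem critTerm_congr (h : ∀ t ∈ clEps Cr, T.termVal t = S.termVal t) {c : EpsAxiom L}
    (hc : c ∈ Cr) : c.critTerm T = c.critTerm S := by
  rw [EpsAxiom.critTerm, EpsAxiom.critTerm, Subst.reduce_congr_of_termVal_eq c.F fun G hG hGc =>
    h _ (eps_mem_clEps hc
      (subTerms_trans _ _ _ (eps_mem_subTerms_formula c) (Or.inr hG)) hGc)]

theorem critVal_congr (h : ∀ t ∈ clEps Cr, T.termVal t = S.termVal t) {c : EpsAxiom L}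
    (hc : c ∈ Cr) : c.critVal T = c.critVal S := by
  rw [EpsAxiom.critVal, EpsAxiom.critVal, Subst.termVal, Subst.termVal,
    Subst.reduce_congr_of_termVal_eq c.t fun G hG hGc =>
      h _ (eps_mem_clEps hc (Or.inr (Or.inl (Or.inl hG))) hGc)]

end Agree

theorem rk_critTerm_lt_RANK {c : EpsAxiom L} (hc : c ∈ Cr) (S : Subst L) :
    Expr.rk (c.critTerm S) < RANK Cr := by
  have h1 : Expr.rk (c.critTerm S) ≤ Expr.rk c.formula :=
    (S.rk_eps_reduce_le c.F).trans
      ((le_max_right _ _).trans ((le_max_left _ _).trans (le_max_right _ _)))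
  have h2 : Expr.rk c.formula ≤ rkCr Cr := by
    rw [rkCr]
    clear h1
    induction Cr with
    | nil => cases hc
    | cons d l ih =>
      rcases List.mem_cons.1 hc with rfl | hc
      · exact le_max_left _ _
      · exact (ih hc).trans (le_max_right _ _)
  rw [RANK]
  omega

namespace Selection

variable {A : Arrangement Cr} (P : Selection A)

/-! ### The H-process -/

/-- The term `e^{S^n}` whose value is changed in the step from `S^n` to `S^{n+1}`. -/
noncomputable def crit (n : ℕ) : Term L := (P.pick (P.S n)).critTerm (P.S n)

theorem canonical_crit (n : ℕ) : Canonical (P.crit n) := EpsAxiom.canonical_critTerm _ _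

/-- The value given to the term `e^{S^n}` in the step from `S^n` to `S^{n+1}`. -/
noncomputable def newVal (n : ℕ) : ℕ := (P.pick (P.S n)).critVal (P.S n)

theorem S_succ {n : ℕ} (h : ¬ Solving Cr (P.S n)) :
    P.S (n + 1) = (P.S n).update (P.crit n) (P.newVal n) (P.canonical_crit n) := by
  rw [S, if_neg h]
  rfl

theorem not_solving_of_le {m n : ℕ} (hmn : m ≤ n) (h : ¬ Solving Cr (P.S n)) :
    ¬ Solving Cr (P.S m) := by
  induction n, hmn using Nat.le_induction with
  | base => exact h
  | succ n _ ih =>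
    refine ih fun hn => h ?_
    rwa [S, if_pos hn]

theorem correct_S (n : ℕ) : (P.S n).Correct := by
  induction n with
  | zero => intro G u hu; simp [S, Subst.empty] at hu
  | succ n ih =>
    by_cases h : Solving Cr (P.S n)
    · rwa [S, if_pos h]
    · rw [P.S_succ h]
      exact ih.update _ (P.false_pick _ h)

theorem r_eq {n : ℕ} (h : ∀ m < n, ¬ Solving Cr (P.S m)) : P.r n = (P.S n).rk := by
  rw [r, if_pos h]

theorem a_eq {n : ℕ} (h : ∀ m < n, ¬ Solving Cr (P.S m)) : P.a n = A.ind (P.S n) := by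
  rw [a, if_pos h]

theorem r_zero : P.r 0 = 0 := by
  rw [P.r_eq (by simp), ← Nat.le_zero]
  exact Finset.sup_le fun f hf => by simp [S, Subst.empty] at hf

theorem r_succ {n : ℕ} (h : ¬ Solving Cr (P.S n)) : P.r (n + 1) = Expr.rk (P.crit n) := by
  rw [P.r_eq fun m hm => P.not_solving_of_le (Nat.lt_succ_iff.1 hm) h, P.S_succ h, Subst.rk_update]

theorem r_succ_pos {n : ℕ} (h : ¬ Solving Cr (P.S n)) : 0 < P.r (n + 1) := by
  rw [P.r_succ h, crit, EpsAxiom.critTerm, Expr.rk]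
  exact lt_max_of_lt_left (Nat.succ_pos _)

theorem r_lt_RANK (n : ℕ) : P.r n < RANK Cr := by
  have h0 : 0 < RANK Cr := lt_max_of_lt_right two_pos
  cases n with
  | zero => rwa [r_zero]
  | succ n =>
    by_cases h : Solving Cr (P.S n)
    · rwa [r, if_neg fun h' => h' n (Nat.lt_succ_self n) h]
    · rw [P.r_succ h]
      exact rk_critTerm_lt_RANK (P.mem _ h) _

/-- As long as only terms of rank greater than `ρ` are changed, the values of terms of rank at most
`ρ` persist. -/
theorem val_eq_of_lt_r {i n ρ : ℕ} (hin : i ≤ n) (hn : ∀ m < n, ¬ Solving Cr (P.S m))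
    (hr : ∀ x, i < x → x ≤ n → ρ < P.r x) {f : Term L} (hf : Expr.rk f ≤ ρ) :
    (P.S n).val f = (P.S i).val f := by
  induction n, hin using Nat.le_induction with
  | base => rfl
  | succ n hin ih =>
    have h1 := hn n (Nat.lt_succ_self n)
    have h2 := hr (n + 1) (by omega) le_rfl
    rw [P.r_succ h1] at h2
    rw [P.S_succ h1, Subst.update_val_of_rk_le _ _ _ (by rintro rfl; omega) (by omega)]
    exact ih (fun m hm => hn m (by omega)) fun x h3 h4 => hr x h3 (by omega)

/-- If the step to `S^k` destroys exactly what was done after `S^i`, then the process, continued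
from `S^k`, repeats what it did from `S^i` on, up to a point `k + D` at which the index is smaller
than it was at `i + D`. -/
theorem exists_a_lt {i k : ℕ} (hik : i < k) (hk : ¬ Solving Cr (P.S (k - 1))) (hr : P.r i ≤ P.r k)
    (hint : ∀ x, i < x → x < k → P.r k < P.r x) :
    ∃ D, i + D < k ∧ (∀ j < D, P.a (k + j) = P.a (i + j)) ∧
      (∀ j, 0 < j → j ≤ D → P.r (k + j) = P.r (i + j)) ∧ P.a (k + D) < P.a (i + D) := by
  obtain ⟨q, rfl⟩ : ∃ q, k = q + 1 := ⟨k - 1, by omega⟩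
  rw [Nat.add_sub_cancel] at hk
  set e := P.crit q with he
  set v := P.newVal q with hv
  have hns : ∀ m < q + 1, ¬ Solving Cr (P.S m) := fun m hm => P.not_solving_of_le (by omega) hk
  have hrk : P.r (q + 1) = Expr.rk e := P.r_succ hk
  have hrange : ∀ j, i + j < q + 1 → ∀ f, Expr.rk f ≤ Expr.rk e →
      (P.S (i + j)).val f = (P.S i).val f := fun j hj f hf =>
    P.val_eq_of_lt_r (by omega) (fun m hm => hns m (by omega))
      (fun x h1 h2 => hrk ▸ hint x h1 (by omega)) hf
  have hlt : ackType v < ackType (((P.S i).val e).getD 0) := by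
    rw [← hrange (q - i) (by omega) e le_rfl, Nat.add_sub_cancel' (by omega)]
    exact EpsAxiom.ackType_critVal_lt _ (P.correct_S q) (P.false_pick _ hk)
  -- As long as the indices agree, `S^{k+j}` is `S^{i+j}` with the value of `e` changed to `v`.
  have run : ∀ j, i + j < q + 1 → (∀ j' < j, P.a (q + 1 + j') = P.a (i + j')) →
      (∀ m < q + 1 + j, ¬ Solving Cr (P.S m)) ∧ (P.S (q + 1 + j)).val e = some v ∧
      (∀ f, f ≠ e → (P.S (q + 1 + j)).val f = (P.S (i + j)).val f) ∧
      (∀ j', 0 < j' → j' ≤ j → P.r (q + 1 + j') = P.r (i + j')) ∧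
      (P.a (q + 1 + j) < P.a (i + j) ∨ P.a (q + 1 + j) = P.a (i + j) ∧
        ∀ t ∈ clEps Cr, (P.S (q + 1 + j)).termVal t = (P.S (i + j)).termVal t) := by
    intro j
    induction j with
    | zero =>
      intro _ _
      have h1 : (P.S (q + 1)).val e = some v := by rw [P.S_succ hk, Subst.update_val_self]
      have h2 : ∀ f, f ≠ e → (P.S (q + 1)).val f = (P.S i).val f := by
        intro f hf
        rw [P.S_succ hk]
        by_cases hfr : Expr.rk f ≤ Expr.rk e
        · rw [Subst.update_val_of_rk_le _ _ _ hf hfr, ← hrange (q - i) (by omega) f hfr,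
            Nat.add_sub_cancel' (by omega)]
        · rw [Subst.update_val_of_lt_rk _ _ _ (not_le.1 hfr), Subst.val_eq_none_of_rk_lt]
          rw [← P.r_eq fun m hm => hns m (by omega)]
          omega
      refine ⟨hns, h1, h2, fun j' h3 h4 => by omega, ?_⟩
      rw [P.a_eq hns, Nat.add_zero, Nat.add_zero, P.a_eq fun m hm => hns m (by omega)]
      exact A.ind_lt_or_termVal_eq h2 (by rw [h1]; exact hlt)
    | succ j ih =>
      intro hj ha
      obtain ⟨hns', hve, hvne, hrj, hd⟩ := ih (by omega) fun j' hj' => ha j' (by omega)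
      have haj := ha j (Nat.lt_succ_self j)
      obtain ⟨-, hag⟩ := hd.resolve_left haj.not_lt
      have hni : ¬ Solving Cr (P.S (i + j)) := hns _ (by omega)
      have hnk : ¬ Solving Cr (P.S (q + 1 + j)) := mt (solving_congr hag).1 hni
      have hpick : P.pick (P.S (q + 1 + j)) = P.pick (P.S (i + j)) := by
        refine P.index_only _ _ hnk hni ?_
        rw [← P.a_eq hns', ← P.a_eq fun m hm => hns m (by omega), haj]
      have hcrit : P.crit (q + 1 + j) = P.crit (i + j) := by
        rw [crit, crit, hpick, critTerm_congr hag (P.mem _ hni)]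
      have hnew : P.newVal (q + 1 + j) = P.newVal (i + j) := by
        rw [newVal, newVal, hpick, critVal_congr hag (P.mem _ hni)]
      have hrlt : Expr.rk e < Expr.rk (P.crit (i + j)) := by
        rw [← hrk, ← P.r_succ hni]
        exact hint _ (by omega) (by omega)
      have hSk := P.S_succ hnk
      simp only [hcrit, hnew] at hSk
      have hns'' : ∀ m < q + 1 + (j + 1), ¬ Solving Cr (P.S m) := fun m hm => by
        rcases Nat.lt_succ_iff_lt_or_eq.1 hm with h | rfl
        · exact hns' m h
        · exact hnk
      have h1 : (P.S (q + 1 + (j + 1))).val e = some v := by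
        rw [← Nat.add_assoc, hSk, Subst.update_val_of_rk_le _ _ _
          (by rintro h; rw [h] at hrlt; omega) (by omega), hve]
      have h2 : ∀ f, f ≠ e → (P.S (q + 1 + (j + 1))).val f = (P.S (i + (j + 1))).val f := by
        intro f hf
        rw [← Nat.add_assoc, ← Nat.add_assoc, hSk, P.S_succ hni]
        simp only [Subst.update, hvne f hf]
      refine ⟨hns'', h1, h2, fun j' h3 h4 => ?_, ?_⟩
      · rcases Nat.lt_succ_iff_lt_or_eq.1 (Nat.lt_succ_iff.2 h4) with h | rfl
        · exact hrj j' h3 (by omega)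
        · rw [← Nat.add_assoc, ← Nat.add_assoc, P.r_succ hnk, P.r_succ hni, hcrit]
      · rw [P.a_eq hns'', P.a_eq fun m hm => hns m (by omega)]
        refine A.ind_lt_or_termVal_eq h2 ?_
        rw [h1, hrange (j + 1) hj e le_rfl]
        exact hlt
  by_cases hall : ∀ j, i + j < q + 1 → P.a (q + 1 + j) = P.a (i + j)
  · -- The axiom chosen at `S^{k-1}` would be chosen again, although it has become true.
    exfalso
    have hq : i + (q - i) = q := Nat.add_sub_cancel' (by omega)
    obtain ⟨hns', hve, -, -, hd⟩ := run (q - i) (by omega) fun j' hj' => hall j' (by omega)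
    have haq := hall (q - i) (by omega)
    obtain ⟨-, hag⟩ := hd.resolve_left haq.not_lt
    rw [hq] at haq hag
    have hnk : ¬ Solving Cr (P.S (q + 1 + (q - i))) := mt (solving_congr hag).1 hk
    have hpick : P.pick (P.S (q + 1 + (q - i))) = P.pick (P.S q) := by
      refine P.index_only _ _ hnk hk ?_
      rw [← P.a_eq hns', ← P.a_eq fun m hm => hns m (by omega), haq]
    have hf := P.false_pick _ hnk
    rw [hpick] at hf
    have := EpsAxiom.ackType_critVal_lt _ (P.correct_S _) hf
    rw [critTerm_congr hag (P.mem _ hk), critVal_congr hag (P.mem _ hk)] at this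
    change ackType v < ackType (((P.S (q + 1 + (q - i))).val e).getD 0) at this
    rw [hve] at this
    exact lt_irrefl _ this
  · simp only [not_forall] at hall
    classical
    obtain ⟨D, ⟨h1, h2⟩, hmin⟩ : ∃ D, (∃ _ : i + D < q + 1, ¬ P.a (q + 1 + D) = P.a (i + D)) ∧
        ∀ j < D, ¬ ∃ _ : i + j < q + 1, ¬ P.a (q + 1 + j) = P.a (i + j) :=
      ⟨Nat.find hall, Nat.find_spec hall, fun _ => Nat.find_min hall⟩
    have heq : ∀ j < D, P.a (q + 1 + j) = P.a (i + j) := fun j hj => by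
      by_contra h
      exact hmin j hj ⟨by omega, h⟩
    obtain ⟨-, -, -, hrj, hd⟩ := run D h1 heq
    exact ⟨D, h1, heq, hrj, hd.resolve_right fun h => h2 h.1⟩

/-! ### Ordinals of series -/

/-- The ordinal of the series `S^m, …, S^{k-1}` at level `RANK - d`. -/
noncomputable def serOrd (d m k : ℕ) : Ordinal.{0} := P.ordAux d (List.range' m (k - m))

theorem serOrd_zero {m k : ℕ} (h : m < k) : P.serOrd 0 m k = P.a m := by
  obtain ⟨l, rfl⟩ : ∃ l, k = m + (l + 1) := ⟨k - m - 1, by omega⟩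
  rw [serOrd, Nat.add_sub_cancel_left, List.range'_succ, ordAux]
  rfl

theorem serOrd_succ_of_forall_ne {d m k : ℕ} (h : m < k)
    (hr : ∀ x, m < x → x < k → P.r x ≠ RANK Cr - (d + 1)) :
    P.serOrd (d + 1) m k = 2 ^ P.serOrd d m k := by
  rw [serOrd, ordAux, List.splitBy_of_isChain, List.map_singleton, List.sum_singleton, serOrd]
  · rw [Ne, List.range'_eq_nil_iff]
    omega
  · rw [List.isChain_iff_getElem]
    intro i hi
    simp only [List.length_range', List.getElem_range'] at hi ⊢
    exact decide_eq_true (hr _ (by omega) (by omega))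

theorem serOrd_succ_of_eq {d m y k : ℕ} (h1 : m < y) (h2 : y < k)
    (hr : P.r y = RANK Cr - (d + 1)) :
    P.serOrd (d + 1) m k = P.serOrd (d + 1) m y + P.serOrd (d + 1) y k := by
  obtain ⟨l, rfl⟩ : ∃ l, k = y + (l + 1) := ⟨k - y - 1, by omega⟩
  have hs : List.range' m (y + (l + 1) - m) =
      List.range' m (y - m) ++ y :: List.range' (y + 1) l := by
    rw [← List.range'_succ, show y + (l + 1) - m = (y - m) + (l + 1) by omega,
      ← List.range'_append_1, Nat.add_sub_cancel' h1.le]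
  rw [serOrd, serOrd, serOrd, hs, Nat.add_sub_cancel_left, List.range'_succ, ordAux, ordAux, ordAux,
    List.splitBy_append_cons, List.map_append, List.sum_append]
  intro x _
  simp [hr]

/-- A series at level `RANK - d`: all substitutions but the first have at least this rank. -/
def AtLevel (d m k : ℕ) : Prop := ∀ x, m < x → x < k → RANK Cr - d ≤ P.r x

variable {P}

theorem AtLevel.mono {d m k m' k' : ℕ} (h : P.AtLevel d m k) (hm : m ≤ m') (hk : k' ≤ k) :
    P.AtLevel d m' k' := fun x h1 h2 => h x (by omega) (by omega)

theorem AtLevel.of_succ {d m k : ℕ} (h : P.AtLevel (d + 1) m k)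
    (hr : ∀ x, m < x → x < k → P.r x ≠ RANK Cr - (d + 1)) : P.AtLevel d m k := fun x h1 h2 => by
  have h3 := h x h1 h2
  have h4 := hr x h1 h2
  omega

theorem AtLevel.eq_succ {m k : ℕ} (h : P.AtLevel 0 m k) (hmk : m < k) : k = m + 1 := by
  by_contra hne
  have h1 := h (m + 1) (by omega) (by omega)
  have h2 := P.r_lt_RANK (m + 1)
  omega

variable (P)

/-- Either a series has no cut at the given level, or it can be split at one. -/
theorem cut_or (d m k : ℕ) : (∀ x, m < x → x < k → P.r x ≠ RANK Cr - (d + 1)) ∨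
    ∃ x, m < x ∧ x < k ∧ P.r x = RANK Cr - (d + 1) := by
  by_contra! h
  obtain ⟨⟨x, h1, h2, h3⟩, h4⟩ := h
  exact h4 x h1 h2 h3

theorem serOrd_succ_pos {d m k : ℕ} (h : m < k) : 0 < P.serOrd (d + 1) m k := by
  induction hn : k - m using Nat.strong_induction_on generalizing m k with
  | _ n ih =>
    rcases P.cut_or d m k with hc | ⟨x, h1, h2, h3⟩
    · rw [P.serOrd_succ_of_forall_ne h hc]
      exact Ordinal.opow_pos _ two_pos
    · rw [P.serOrd_succ_of_eq h1 h2 h3]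
      exact (ih (x - m) (by omega) h1 rfl).trans_le le_self_add

theorem serOrd_congr {d m k m' : ℕ} (l : ℕ) (hk : k = m + l) (hl : 0 < l)
    (ha : ∀ j < l, P.a (m' + j) = P.a (m + j))
    (hr : ∀ j, 0 < j → j < l → P.r (m' + j) = P.r (m + j)) :
    P.serOrd d m' (m' + l) = P.serOrd d m k := by
  subst hk
  induction d generalizing m m' l with
  | zero =>
    rw [P.serOrd_zero (by omega), P.serOrd_zero (by omega)]
    exact ha 0 hl
  | succ d ihd =>
    induction l using Nat.strong_induction_on generalizing m m' with
    | _ l ih =>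
      rcases P.cut_or d m (m + l) with hc | ⟨x, h1, h2, h3⟩
      · rw [P.serOrd_succ_of_forall_ne (by omega) hc, P.serOrd_succ_of_forall_ne (by omega),
          ihd l hl ha hr]
        intro x h1 h2
        have := hr (x - m') (by omega) (by omega)
        rw [Nat.add_sub_cancel' h1.le] at this
        rw [this]
        exact hc _ (by omega) (by omega)
      · obtain ⟨j, rfl⟩ : ∃ j, x = m + j := ⟨x - m, by omega⟩
        obtain ⟨l', rfl⟩ : ∃ l', l = j + l' := ⟨l - j, by omega⟩
        have h4 : P.r (m' + j) = P.r (m + j) := hr j (by omega) (by omega)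
        rw [P.serOrd_succ_of_eq h1 h2 h3,
          P.serOrd_succ_of_eq (y := m' + j) (by omega) (by omega) (h4.trans h3),
          ih j (by omega) (by omega) (fun i hi => ha i (by omega))
            (fun i h5 h6 => hr i h5 (by omega)), ← Nat.add_assoc, ← Nat.add_assoc,
          ih l' (by omega) (by omega) (fun i hi => ?_) (fun i h5 h6 => ?_)]
        · simpa only [Nat.add_assoc] using ha (j + i) (by omega)
        · simpa only [Nat.add_assoc] using hr (j + i) (by omega) (by omega)

/-- Ordinals do not increase when an initial part of the series is removed: in each sum, whole
summands are dropped from the left, and the exponent of the next one does not increase. -/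
theorem serOrd_le_of_le {d m i k : ℕ} (hmi : m ≤ i) (hik : i < k) (h : P.AtLevel d m k) :
    P.serOrd d i k ≤ P.serOrd d m k := by
  induction d generalizing m i k with
  | zero =>
    have := h.eq_succ (by omega)
    obtain rfl : m = i := by omega
    exact le_rfl
  | succ d ihd =>
    induction hn : k - m using Nat.strong_induction_on generalizing m i k with
    | _ n ih =>
      rcases P.cut_or d m k with hc | ⟨x, h1, h2, h3⟩
      · rw [P.serOrd_succ_of_forall_ne (by omega) hc, P.serOrd_succ_of_forall_ne hik
          fun x h1 h2 => hc x (by omega) h2]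
        exact Ordinal.opow_le_opow_right two_pos (ihd hmi hik (h.of_succ hc))
      · rw [P.serOrd_succ_of_eq h1 h2 h3]
        by_cases hix : i < x
        · rw [P.serOrd_succ_of_eq hix h2 h3]
          exact add_le_add_left (ih (x - m) (by omega) hmi hix (h.mono le_rfl h2.le) rfl) _
        · exact (ih (k - x) (by omega) (not_lt.1 hix) hik (h.mono h1.le le_rfl) rfl).trans
            le_add_self

/-- Ordinals decrease strictly when a final part of the series is removed. -/
theorem serOrd_lt_of_lt {d m l k : ℕ} (hml : m < l) (hlk : l < k) (h : P.AtLevel d m k) :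
    P.serOrd d m l < P.serOrd d m k := by
  induction d generalizing m l k with
  | zero =>
    have := h.eq_succ (by omega)
    omega
  | succ d ihd =>
    induction hn : k - m using Nat.strong_induction_on generalizing m l k with
    | _ n ih =>
      rcases P.cut_or d m k with hc | ⟨x, h1, h2, h3⟩
      · rw [P.serOrd_succ_of_forall_ne (by omega) hc, P.serOrd_succ_of_forall_ne hml
          fun x h1 h2 => hc x h1 (by omega)]
        exact (Ordinal.opow_lt_opow_iff_right one_lt_two).2 (ihd hml hlk (h.of_succ hc))
      · rw [P.serOrd_succ_of_eq h1 h2 h3]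
        rcases lt_trichotomy l x with hlx | rfl | hlx
        · exact (ih (x - m) (by omega) hml hlx (h.mono le_rfl h2.le) rfl).trans_le le_self_add
        · exact lt_add_of_pos_right _ (P.serOrd_succ_pos h2)
        · rw [P.serOrd_succ_of_eq h1 hlx h3]
          exact add_lt_add_right (ih (k - x) (by omega) hlx hlk (h.mono h1.le le_rfl) rfl) _

/-- The ordinals of consecutive pieces of the series `S^y, …, S^{z-1}` decrease at every level, so
that the ordinal of the series is a sum of powers of `2` in normal form. -/
def Descending (y z : ℕ) : Prop :=
  ∀ d y' w z', d ≤ RANK Cr → y ≤ y' → y' < w → w < z' → z' ≤ z →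
    P.r y' ≤ P.r w → RANK Cr - d = P.r w →
    (∀ x, y' < x → x < w → P.r w < P.r x) → (∀ x, w < x → x < z' → P.r w ≤ P.r x) →
    P.serOrd d w z' < P.serOrd d y' w

variable {P} in
theorem Descending.mono {y z y' z' : ℕ} (h : P.Descending y z) (hy : y ≤ y') (hz : z' ≤ z) :
    P.Descending y' z' := fun d u w v h0 h1 h2 h3 h4 =>
  h d u w v h0 (by omega) h2 h3 (by omega)

/-- `w` is the place of the first cut of the series, or its end if there is none. -/
theorem exists_first_cut (d m k D : ℕ) (hmk : m + D < k)
    (hD : ∀ x, m < x → x ≤ m + D → P.r x ≠ RANK Cr - (d + 1)) :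
    ∃ w, m + D < w ∧ w ≤ k ∧ (∀ x, m < x → x < w → P.r x ≠ RANK Cr - (d + 1)) ∧
      (w < k → P.r w = RANK Cr - (d + 1)) := by
  classical
  have hex : ∃ w, m + D < w ∧ (w = k ∨ P.r w = RANK Cr - (d + 1)) := ⟨k, hmk, Or.inl rfl⟩
  have hle := Nat.find_min' hex ⟨hmk, Or.inl rfl⟩
  obtain ⟨h1, h2⟩ := Nat.find_spec hex
  refine ⟨Nat.find hex, h1, hle, fun x h3 h4 h5 => ?_, fun h3 => h2.resolve_left h3.ne⟩
  rcases le_or_gt x (m + D) with h6 | h6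
  · exact hD x h3 h6 h5
  · exact Nat.find_min hex h4 ⟨h6, Or.inr h5⟩

/-- The ordinals of two series are compared at the first place where they differ, provided that the
smaller one is in normal form. -/
theorem serOrd_lt_serOrd {d i k y z : ℕ} (D : ℕ) (hdR : d ≤ RANK Cr) (hik : i + D < k) (hyz : y < z)
    (hT : P.AtLevel d i k) (hT' : P.AtLevel d y z) (hd : P.Descending y z)
    (hy : P.r y ≤ RANK Cr - d)
    (ha : ∀ j < D, P.a (y + j) = P.a (i + j))
    (hr : ∀ j, 0 < j → j ≤ D → P.r (y + j) = P.r (i + j))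
    (hlt : P.a (y + D) < P.a (i + D)) : P.serOrd d y z < P.serOrd d i k := by
  by_cases hz : z ≤ y + D
  · have := P.serOrd_congr (d := d) (m := i) (k := i + (z - y)) (m' := y) (z - y) rfl (by omega)
      (fun j hj => ha j (by omega)) (fun j h1 h2 => hr j h1 (by omega))
    rw [Nat.add_sub_cancel' hyz.le] at this
    rw [this]
    exact P.serOrd_lt_of_lt (by omega) (by omega) hT
  rw [not_le] at hz
  induction d generalizing i k y z D with
  | zero =>
    have h1 := hT.eq_succ (by omega)
    obtain rfl : D = 0 := by omega
    rw [P.serOrd_zero hyz, P.serOrd_zero (by omega)]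
    exact hlt
  | succ d ihd =>
    induction D using Nat.strong_induction_on generalizing i k y z with
    | _ D ih =>
      by_cases hc : ∃ j, 0 < j ∧ j ≤ D ∧ P.r (i + j) = RANK Cr - (d + 1)
      · obtain ⟨j, h1, h2, h3⟩ := hc
        obtain ⟨D', rfl⟩ : ∃ D', D = j + D' := ⟨D - j, by omega⟩
        have h4 := (hr j h1 h2).trans h3
        rw [P.serOrd_succ_of_eq (m := i) (k := k) (by omega) (by omega) h3,
          P.serOrd_succ_of_eq (m := y) (k := z) (by omega) (by omega) h4,
          P.serOrd_congr (m := i) (k := i + j) j rfl h1 (fun l hl => ha l (by omega))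
            (fun l h5 h6 => hr l h5 (by omega))]
        refine add_lt_add_right (ih D' (by omega) (i := i + j) (k := k) (y := y + j) (z := z)
          (by omega) (by omega)
          (hT.mono (by omega) le_rfl) (hT'.mono (by omega) le_rfl) (hd.mono (by omega) le_rfl)
          h4.le (fun l hl => ?_) (fun l h5 h6 => ?_) ?_ (by omega)) _
        · simpa only [Nat.add_assoc] using ha (j + l) (by omega)
        · simpa only [Nat.add_assoc] using hr (j + l) (by omega) (by omega)
        · simpa only [Nat.add_assoc] using hlt
      · -- Both series differ inside of their first pieces.
        push Not at hc
        obtain ⟨w, hw1, hw2, hw3, hw4⟩ := P.exists_first_cut d i k D hik fun x h1 h2 => by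
          have := hc (x - i) (by omega) (by omega)
          rwa [Nat.add_sub_cancel' h1.le] at this
        obtain ⟨u, hu1, hu2, hu3, hu4⟩ := P.exists_first_cut d y z D hz fun x h1 h2 => by
          have h3 := hc (x - y) (by omega) (by omega)
          rw [← hr (x - y) (by omega) (by omega), Nat.add_sub_cancel' h1.le] at h3
          exact h3
        have hlt' : P.serOrd d y u < P.serOrd d i w := by
          refine ihd D (by omega) hw1 (by omega) ((hT.mono le_rfl hw2).of_succ hw3)
            ((hT'.mono le_rfl hu2).of_succ hu3) (hd.mono le_rfl hu2) (by omega) ha hr hlt hu1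
        have hw : (2 : Ordinal) ^ P.serOrd d i w ≤ P.serOrd (d + 1) i k := by
          rw [← P.serOrd_succ_of_forall_ne (by omega) hw3]
          rcases hw2.eq_or_lt with rfl | hwk
          · exact le_rfl
          · rw [P.serOrd_succ_of_eq (y := w) (by omega) hwk (hw4 hwk)]
            exact le_self_add
        refine lt_of_lt_of_le ?_ hw
        have hu := P.serOrd_succ_of_forall_ne (by omega) hu3
        rcases hu2.eq_or_lt with rfl | huz
        · rw [hu]
          exact (Ordinal.opow_lt_opow_iff_right one_lt_two).2 hlt'
        · have hru := hu4 huz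
          have hd' : P.serOrd (d + 1) u z < P.serOrd (d + 1) y u := by
            refine hd (d + 1) y u z hdR le_rfl (by omega) huz le_rfl (by omega) hru.symm
              (fun x h1 h2 => ?_) (fun x h1 h2 => ?_)
            · rw [hru]
              exact lt_of_le_of_ne (hT' x h1 (by omega)) (hu3 x h1 h2).symm
            · rw [hru]
              exact hT' x (by omega) h2
          rw [P.serOrd_succ_of_eq (y := u) (by omega) huz hru]
          calc P.serOrd (d + 1) y u + P.serOrd (d + 1) u z
              < P.serOrd (d + 1) y u + P.serOrd (d + 1) y u := add_lt_add_right hd' _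
            _ = 2 ^ (P.serOrd d y u + 1) := by
              rw [hu, Ordinal.opow_add_one]
              generalize (2 : Ordinal) ^ P.serOrd d y u = o
              rw [← one_add_one_eq_two, mul_add_one, mul_one]
            _ ≤ 2 ^ P.serOrd d i w :=
              Ordinal.opow_le_opow_right two_pos (Order.add_one_le_of_lt hlt')

/-- Ackermann's lemma: if the step to `S^k` destroys exactly what was done after `S^i`, then the
series from `S^k` on has a smaller ordinal than the one from `S^i` to `S^{k-1}`. -/
theorem serOrd_lt_of_lt_r {i k l d : ℕ} (hik : i < k) (hkl : k < l)
    (hdR : d ≤ RANK Cr)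
    (hns : ∀ m < l, ¬ Solving Cr (P.S m)) (hr : P.r i ≤ P.r k)
    (hint : ∀ x, i < x → x < k → P.r k < P.r x) (hint' : ∀ x, k < x → x < l → P.r k ≤ P.r x)
    (hd : RANK Cr - d ≤ P.r k) : P.serOrd d k l < P.serOrd d i k := by
  induction hn : l - k using Nat.strong_induction_on generalizing i k l d with
  | _ n ih =>
    obtain ⟨D, h1, h2, h3, h4⟩ := P.exists_a_lt hik (hns (k - 1) (by omega)) hr hint
    induction d with
    | zero =>
      have := P.r_lt_RANK k
      omega
    | succ d ihd =>
      by_cases hd' : RANK Cr - d ≤ P.r k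
      · rw [P.serOrd_succ_of_forall_ne hkl fun x h5 h6 => by have := hint' x h5 h6; omega,
          P.serOrd_succ_of_forall_ne hik fun x h5 h6 => by have := hint x h5 h6; omega]
        exact (Ordinal.opow_lt_opow_iff_right one_lt_two).2 (ihd (by omega) hd')
      · refine P.serOrd_lt_serOrd D hdR h1 hkl
          (fun x h5 h6 => by have := hint x h5 h6; omega)
          (fun x h5 h6 => by have := hint' x h5 h6; omega) ?_ (by omega) h2 h3 h4
        intro d' y w z g0 g1 g2 g3 g4 g5 g6 g7 g8
        exact ih (z - w) (by omega) g2 g3 g0 (fun m hm => hns m (by omega)) g5 g7 g8 g6.le rfl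

/-- The comparison that keeps the recursion for `M` going: consecutive series have decreasing
ordinals, if the second one starts at its minimal rank and this is at least the initial rank of the
first one. -/
theorem ord_lt_ord {n k l : ℕ} (hnk : n < k) (hkl : k < l)
    (hns : ∀ m < l, ¬ Solving Cr (P.S m)) (hr : P.r n ≤ P.r k)
    (hint : ∀ x, k < x → x < l → P.r k ≤ P.r x) : P.ord k l 0 < P.ord n k 0 := by
  -- `i` is the last place before `k` whose rank is not larger than the rank at `k`
  obtain ⟨i, hi, hmax⟩ := ((Finset.Ico n k).filter fun i => P.r i ≤ P.r k).exists_max_image id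
    ⟨n, by simp [hnk, hr]⟩
  simp only [Finset.mem_filter, Finset.mem_Ico, id] at hi hmax
  have h1 : P.serOrd (RANK Cr) k l < P.serOrd (RANK Cr) i k := by
    refine P.serOrd_lt_of_lt_r hi.1.2 hkl le_rfl hns hi.2 (fun x h2 h3 => ?_) hint (by omega)
    by_contra h4
    have := hmax x ⟨⟨by omega, h3⟩, not_lt.1 h4⟩
    omega
  exact h1.trans_le (P.serOrd_le_of_le hi.1.1 hi.1.2 fun x _ _ => by omega)

end Selection

/-! ### Chains of steps to the next smaller value -/

section Falls

variable {r : ℕ → ℕ}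

/-- From `x` one can go `q` times to the next place at which `r` is smaller, without leaving the
places below `k`. -/
def Falls (r : ℕ → ℕ) : ℕ → ℕ → ℕ → Prop
  | 0, x, k => x < k
  | q + 1, x, k => ∃ y, x < y ∧ r y < r x ∧ (∀ z, x < z → z < y → r x ≤ r z) ∧ Falls r q y k

theorem Falls.lt {q x k : ℕ} (h : Falls r q x k) : x < k := by
  induction q generalizing x with
  | zero => exact h
  | succ q ih =>
    obtain ⟨y, h1, -, -, h2⟩ := h
    exact h1.trans (ih h2)

theorem Falls.of_succ {q x k : ℕ} (h : Falls r (q + 1) x k) : Falls r q x k := by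
  induction q generalizing x with
  | zero => exact h.lt
  | succ q ih =>
    obtain ⟨y, h1, h2, h3, h4⟩ := h
    exact ⟨y, h1, h2, h3, ih h4⟩

theorem Falls.add_lt {q x k c : ℕ} (h : Falls r q x k) (hc : ∀ y, x ≤ y → y < k → c < r y) :
    c + q < r x := by
  induction q generalizing x with
  | zero => exact hc x le_rfl h
  | succ q ih =>
    obtain ⟨y, h1, h2, h3, h4⟩ := h
    have := ih h4 fun z hz => hc z (by omega)
    omega

theorem Falls.one {x k : ℕ} (h : ∃ y, x < y ∧ y < k ∧ r y < r x) : Falls r 1 x k := by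
  classical
  obtain ⟨h1, h2, h3⟩ := Nat.find_spec h
  refine ⟨Nat.find h, h1, h3, fun z h4 h5 => ?_, h2⟩
  by_contra h6
  exact Nat.find_min h h5 ⟨h4, by omega, not_le.1 h6⟩

/-- A place `j` whose value is not larger than any later one ends every chain that reaches it, and
no chain can jump over it, so that only the last step of a chain can leave the places below `j`. -/
theorem Falls.of_forall_le {q x j k : ℕ} (h : Falls r (q + 1) x k) (hxj : x < j)
    (hj : ∀ z, j < z → z < k → r j ≤ r z) : Falls r q x j := by
  induction q generalizing x with
  | zero => exact hxj
  | succ q ih =>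
    obtain ⟨y, h1, h2, h3, h4⟩ := h
    refine ⟨y, h1, h2, h3, ?_⟩
    rcases lt_trichotomy y j with h5 | rfl | h5
    · exact ih h4 h5
    · obtain ⟨z, h6, h7, -, h8⟩ := h4
      exact absurd (hj z h6 h8.lt) (not_le.2 h7)
    · have h6 := h3 j hxj h5
      have h7 := hj y h5 h4.lt
      omega

/-- If all places inside `(i, j)` are followed by a smaller value below `k`, then a chain inside
`(i, j)` can be continued by one step. -/
theorem Falls.succ {q x i j k : ℕ} (h : Falls r q x j) (hix : i < x)
    (hn : ∀ z, i < z → z < j → ∃ y, z < y ∧ y < k ∧ r y < r z) : Falls r (q + 1) x k := by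
  induction q generalizing x with
  | zero => exact Falls.one (hn x hix h)
  | succ q ih =>
    obtain ⟨y, h1, h2, h3, h4⟩ := h
    exact ⟨y, h1, h2, h3, ih h4 (by omega)⟩

/-- A chain that fits below `m + 1` but not below `m` ends at `m`, and can be continued from
there. -/
theorem Falls.or_succ {q x m k : ℕ} (h : Falls r q x (m + 1))
    (hm : ∃ y, m < y ∧ y < k ∧ r y < r m) : Falls r q x m ∨ Falls r (q + 1) x k := by
  induction q generalizing x with
  | zero =>
    rcases Nat.lt_succ_iff_lt_or_eq.1 h.lt with h1 | rfl
    · exact Or.inl h1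
    · exact Or.inr (Falls.one hm)
  | succ q ih =>
    obtain ⟨y, h1, h2, h3, h4⟩ := h
    exact (ih h4).imp (fun h => ⟨y, h1, h2, h3, h⟩) (fun h => ⟨y, h1, h2, h3, h⟩)

end Falls

namespace Selection

variable {A : Arrangement Cr} (P : Selection A)

/-! ### Sections and p-series -/

theorem le_serRk_iff {c m k : ℕ} :
    c ≤ P.serRk m k ↔ c ≤ RANK Cr ∧ ∀ x, m < x → x < k → c ≤ P.r x := by
  refine (Finset.le_min'_iff _ _).trans ?_
  simp only [Finset.mem_union, Finset.mem_image, Finset.mem_Ioo, Finset.mem_singleton]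
  constructor
  · exact fun h => ⟨h _ (Or.inr rfl), fun x h1 h2 => h _ (Or.inl ⟨x, ⟨h1, h2⟩, rfl⟩)⟩
  · rintro ⟨h1, h2⟩ _ (⟨x, ⟨h3, h4⟩, rfl⟩ | rfl)
    · exact h2 x h3 h4
    · exact h1

theorem r_le_serRk_iff {m k : ℕ} :
    P.r m ≤ P.serRk m k ↔ ∀ x, m < x → x < k → P.r m ≤ P.r x := by
  rw [le_serRk_iff, and_iff_right (P.r_lt_RANK m).le]

theorem isSection_iff {m k : ℕ} :
    P.IsSection m k ↔ ∀ x, m < x → x < k → P.r m < P.r x := by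
  rw [IsSection, ← Nat.succ_le_iff, le_serRk_iff, and_iff_right (Nat.succ_le_of_lt (P.r_lt_RANK m))]
  rfl

theorem mem_nd_iff {m k n : ℕ} :
    n ∈ P.nd m k ↔ m ≤ n ∧ n < k ∧ ∀ x, n < x → x < k → P.r n ≤ P.r x := by
  rw [← r_le_serRk_iff]
  rfl

theorem exists_isComponent {m k x : ℕ} (hm : m ∈ P.nd m k) (hmx : m < x) (hxk : x < k)
    (hx : x ∉ P.nd m k) : ∃ i j, P.IsComponent m k i j ∧ i < x ∧ x < j := by
  classical
  obtain ⟨i, hi, hmax⟩ := ((Finset.Ico m x).filter fun i => i ∈ P.nd m k).exists_max_image id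
    ⟨m, by simp [hm, hmx]⟩
  simp only [Finset.mem_filter, Finset.mem_Ico, id] at hi hmax
  have hex : ∃ j, x < j ∧ (j ∈ P.nd m k ∨ j = k) := ⟨k, hxk, Or.inr rfl⟩
  obtain ⟨h1, h2⟩ := Nat.find_spec hex
  refine ⟨i, Nat.find hex, ⟨hi.2, h2, by omega, fun n hn h3 => ?_⟩, hi.1.2, h1⟩
  rcases lt_trichotomy n x with h4 | rfl | h4
  · have := hmax n ⟨⟨by omega, h4⟩, hn⟩
    omega
  · exact hx hn
  · exact Nat.find_min hex h3.2 ⟨h4, Or.inl hn⟩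

variable {P}

theorem IsComponent.mem_interior {m k i j x : ℕ} (h : P.IsComponent m k i j) (h1 : i < x)
    (h2 : x < j) : m < x ∧ x < k ∧ ∃ y, x < y ∧ y < k ∧ P.r y < P.r x := by
  obtain ⟨hi, hj, hij, hn⟩ := h
  rw [mem_nd_iff] at hi
  have hjk : j ≤ k := hj.elim (fun h => ((P.mem_nd_iff).1 h).2.1.le) le_of_eq
  refine ⟨by omega, by omega, ?_⟩
  by_contra! hx
  exact hn x ((P.mem_nd_iff).2 ⟨by omega, by omega, hx⟩) ⟨h1, h2⟩

theorem IsComponent.isSection {m k i j : ℕ} (h : P.IsComponent m k i j) : P.IsSection i j := by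
  rw [isSection_iff]
  intro x h1 h2
  obtain ⟨h3, h4, y, h5, h6, h7⟩ := h.mem_interior h1 h2
  have := ((P.mem_nd_iff).1 h.1).2.2 y (by omega) h6
  omega

variable (P)

/-- A series whose first rank is minimal is a `p`-series if and only if no chain of `p` successive
steps to the next place of smaller rank fits in it. -/
theorem isPSeries_iff {p m k : ℕ} : P.IsPSeries p m k ↔
    m < k ∧ (∀ x, m < x → x < k → P.r m ≤ P.r x) ∧ ∀ x, m < x → ¬ Falls P.r p x k := by
  induction p generalizing m k with
  | zero =>
    rw [IsPSeries, r_le_serRk_iff]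
    constructor
    · rintro ⟨h1, h2, rfl⟩
      exact ⟨h1, h2, fun x h3 h4 => by have := h4.lt; omega⟩
    · rintro ⟨h1, h2, h3⟩
      refine ⟨h1, h2, ?_⟩
      by_contra h4
      exact h3 (m + 1) (by omega) (show m + 1 < k by omega)
  | succ p ih =>
    rw [IsPSeries, r_le_serRk_iff]
    refine and_congr_right fun hmk => and_congr_right fun hr => ⟨fun h x hmx hf => ?_,
      fun h i j hc => ⟨?_, hc.isSection⟩⟩
    · have hx : x ∉ P.nd m k := fun hx => by
        obtain ⟨y, h1, h2, -, h4⟩ := hf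
        have := ((P.mem_nd_iff).1 hx).2.2 y h1 h4.lt
        omega
      obtain ⟨i, j, hc, hix, hxj⟩ :=
        P.exists_isComponent ((P.mem_nd_iff).2 ⟨le_rfl, hmk, hr⟩) hmx hf.lt hx
      refine (ih.1 (h i j hc).1).2.2 x hix ?_
      rcases hc.2.1 with hj | rfl
      · exact hf.of_forall_le hxj ((P.mem_nd_iff).1 hj).2.2
      · exact hf.of_succ
    · refine ih.2 ⟨hc.2.2.1, fun x h1 h2 => ((P.isSection_iff).1 hc.isSection x h1 h2).le,
        fun x h1 h2 => ?_⟩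
      exact h x (hc.mem_interior h1 h2.lt).1
        (h2.succ h1 fun z h3 h4 => (hc.mem_interior h3 h4).2.2)

variable {P}

theorem IsPSeries.succ {p m k : ℕ} (h : P.IsPSeries p m k) : P.IsPSeries (p + 1) m k := by
  rw [isPSeries_iff] at h ⊢
  exact ⟨h.1, h.2.1, fun x h1 h2 => h.2.2 x h1 h2.of_succ⟩

/-- A `p`-series followed by a `(p+1)`-series of no smaller initial rank is a `(p+1)`-series. -/
theorem IsPSeries.append {p n m k : ℕ} (h : P.IsPSeries p n m) (h' : P.IsPSeries (p + 1) m k)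
    (hr : P.r n ≤ P.r m) : P.IsPSeries (p + 1) n k := by
  rw [isPSeries_iff] at h h' ⊢
  refine ⟨h.1.trans h'.1, fun x h1 h2 => ?_, fun x h1 h2 => ?_⟩
  · rcases lt_trichotomy x m with h3 | rfl | h3
    · exact h.2.1 x h1 h3
    · exact hr
    · exact hr.trans (h'.2.1 x h3 h2)
  · rcases lt_trichotomy x m with h3 | rfl | h3
    · exact h.2.2 x h1 (h2.of_forall_le h3 h'.2.1)
    · obtain ⟨y, h4, h5, -, h6⟩ := h2
      exact absurd (h'.2.1 y h4 h6.lt) (not_le.2 h5)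
    · exact h'.2.2 x h3 h2

/-- If an initial part of a `(p+1)`-series is a maximal `p`-series, then what remains is again a
`(p+1)`-series. -/
theorem IsPSeries.drop {p n m k : ℕ} (h : P.IsPSeries (p + 1) n k) (hnm : n < m) (hmk : m < k)
    (hmax : ¬ P.IsPSeries p n (m + 1)) (hm : P.IsPSeries p n m) : P.IsPSeries (p + 1) m k := by
  rw [isPSeries_iff] at h hmax hm ⊢
  refine ⟨hmk, ?_, fun x h1 => h.2.2 x (by omega)⟩
  by_contra! hlt
  exact hmax ⟨by omega, fun x h4 h5 => h.2.1 x h4 (by omega), fun x h4 h5 =>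
    (h5.or_succ hlt).elim (hm.2.2 x h4) (h.2.2 x h4)⟩

variable (P)

/-- The ranks after `S^0` are at least `1` and below `RANK`, so that there is no room for a chain of
`RANK - 1` steps. -/
theorem isPSeries_zero_left {k : ℕ} (hk : ¬ Solving Cr (P.S k)) :
    P.IsPSeries (RANK Cr - 1) 0 (k + 1) := by
  rw [isPSeries_iff]
  refine ⟨Nat.succ_pos k, fun x _ _ => P.r_zero.trans_le (Nat.zero_le _), fun x h1 h2 => ?_⟩
  have h3 : 0 + (RANK Cr - 1) < P.r x := h2.add_lt fun y h3 h4 => by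
    obtain ⟨y, rfl⟩ : ∃ y', y = y' + 1 := ⟨y - 1, by omega⟩
    exact P.r_succ_pos (P.not_solving_of_le (by omega) hk)
  have := P.r_lt_RANK x
  omega

/-! ### The function `M` -/

theorem M_succ_of_solving {p n : ℕ} (h : Solving Cr (P.S n)) : P.M (p + 1) n = n := by
  rw [M, nextM, if_pos h]

theorem lt_of_isNormalPSeries {p n k : ℕ} (h : P.IsNormalPSeries p n k) : n < k :=
  ((P.isPSeries_iff).1 h.1).1

theorem isNormalPSeries_M (p n : ℕ) (h : ¬ Solving Cr (P.S n)) :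
    P.IsNormalPSeries p n (P.M p n) := by
  induction p generalizing n with
  | zero =>
    refine ⟨(P.isPSeries_iff).2 ⟨Nat.lt_succ_self n, fun x h1 h2 => ?_, fun x h1 h2 => ?_⟩,
      fun _ => h⟩
    · simp only [M] at h2
      omega
    · have := h2.lt
      simp only [M] at this
      omega
  | succ p ih =>
    have hp := ih n h
    have hp1 : P.IsNormalPSeries (p + 1) n (P.M p n) := ⟨hp.1.succ, hp.2⟩
    induction ho : P.ord n (P.M p n) 0 using WellFoundedLT.induction generalizing n with
    | ind o iho =>
      subst ho
      rw [M, nextM, if_neg h]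
      split_ifs with h1 h2
      · exact hp1
      · by_cases hM : Solving Cr (P.S (P.M p n))
        · rw [nextM, if_pos hM]
          exact hp1
        · have hq := ih _ hM
          have := iho _ h1 _ hM hq ⟨hq.1.succ, hq.2⟩ rfl
          refine ⟨hp.1.append this.1 (not_lt.1 h2), fun _ => this.2 (P.lt_of_isNormalPSeries this)⟩
      · exact hp1

theorem M_le_M_succ (p n : ℕ) (h : ¬ Solving Cr (P.S n)) : P.M p n ≤ P.M (p + 1) n := by
  rw [M, nextM, if_neg h]
  split_ifs with h1 h2
  · exact le_rfl
  · change P.M p n ≤ P.M (p + 1) (P.M p n)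
    by_cases hM : Solving Cr (P.S (P.M p n))
    · rw [P.M_succ_of_solving hM]
    · exact (P.lt_of_isNormalPSeries (P.isNormalPSeries_M _ _ hM)).le
  · exact le_rfl

theorem le_M_of_isNormalPSeries (p n k : ℕ) (h : P.IsNormalPSeries p n k) : k ≤ P.M p n := by
  induction p generalizing n k with
  | zero => exact h.1.2.2.le
  | succ p ih =>
    induction hl : k - n using Nat.strong_induction_on generalizing n with
    | _ l ihl =>
      have hnk := P.lt_of_isNormalPSeries h
      have hk := h.2 hnk
      have hn : ¬ Solving Cr (P.S n) := P.not_solving_of_le (by omega) hk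
      rcases le_or_gt k (P.M p n) with hkM | hMk
      · exact hkM.trans (P.M_le_M_succ p n hn)
      set m := P.M p n with hm
      have hp := P.isNormalPSeries_M p n hn
      rw [← hm] at hp
      have hnm := P.lt_of_isNormalPSeries hp
      have hms : ¬ Solving Cr (P.S m) := P.not_solving_of_le (by omega) hk
      have hr : P.r n ≤ P.r m := ((P.isPSeries_iff).1 h.1).2.1 m hnm hMk
      have hq := P.isNormalPSeries_M p m hms
      have hql := P.lt_of_isNormalPSeries hq
      have hlt : P.ord m (P.M p m) 0 < P.ord n m 0 :=
        P.ord_lt_ord hnm hql (fun x hx => P.not_solving_of_le (by omega) (hq.2 hql)) hr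
          ((P.isPSeries_iff).1 hq.1).2.1
      have hd : P.IsPSeries (p + 1) m k := h.1.drop hnm hMk (fun hc => by
        have := ih n (m + 1) ⟨hc, fun _ => hms⟩
        omega) hp.1
      have hM : P.M (p + 1) n = P.M (p + 1) m := by
        rw [M, nextM, if_neg hn, if_pos (by exact hlt), if_neg (by exact not_lt.2 hr)]
        rfl
      rw [hM]
      exact ihl (k - m) (by omega) m ⟨hd, fun _ => hk⟩ rfl

end Selection

end EpsPA

theorem mainTheorem3 (L : EpsPA.Signature) (Cr : List (EpsPA.EpsAxiom L))
    (A : EpsPA.Arrangement Cr) (P : EpsPA.Selection A) :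
    (∀ p n : ℕ, ¬ EpsPA.Solving Cr (P.S n) → P.IsNormalPSeries p n (P.M p n)) ∧
    (∀ p n k : ℕ, P.IsNormalPSeries p n k → k ≤ P.M p n) ∧
    EpsPA.Solving Cr (P.S (P.M (EpsPA.RANK Cr - 1) 0)) := by
  refine ⟨P.isNormalPSeries_M, P.le_M_of_isNormalPSeries, ?_⟩
  by_contra h
  exact absurd (P.le_M_of_isNormalPSeries _ _ _ ⟨P.isPSeries_zero_left h, fun _ => h⟩)
    (not_le.2 (Nat.lt_succ_self _))
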